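/- **Proposition.** Let $(M,g)$ be a smooth finite-dimensional Riemannian manifold with Levi-Civita connection $\nabla$ and curvature tensor $\mathfrak{R}(X,Y)Z=\nabla_X\nabla_YZ-\nabla_Y\nabla_XZ-\nabla_{[X,Y]}Z$. Let $\pi:TM\to M$ be the projection and, for $(p,u)\in TM$, let $K:T_{(p,u)}TM\to T_pM$ be the connection map of $\nabla$, i.e. the linear map given in induced coordinates $(x,y)$ on $TM$ by $K(\dot x,\dot y)=\dot y+\Gamma(\dot x,u)$, where $\Gamma$ denotes the Christoffel symbols of $\nabla$; it satisfies $K(d\sigma(v))=\nabla_v\sigma$ for all vector fields $\sigma$ on $M$ with $\sigma(p)=u$ and all $v\in T_pM$. For a vector field $X$ on $M$ let $X^h$ (horizontal lift) and $X^v$ (vertical lift) be the vector fields on $TM$ with $d\pi(X^h)=X$, $K(X^h)=0$ and $d\pi(X^v)=0$, $K(X^v)=X$. Let $m_1,m_2,m_3\in\mathbb{R}$ with $m_1,m_3>0$ and $m_1m_3-m_2^2>0$, and let $\bar g$ be the metric on $TM$ determined by $$\bar g(X^h,Y^h)=m_1\,g(X,Y),\qquad \bar g(X^h,Y^v)=m_2\,g(X,Y),\qquad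 \bar g(X^v,Y^v)=m_3\,g(X,Y).$$ Let $\bar\nabla$ be the Levi-Civita connection of $(TM,\bar g)$. Then for all smooth vector fields $X,Y,Z$ on $M$ and all $(p,u)\in TM$, with the left-hand sides evaluated at $(p,u)$ and the right-hand sides at $p$: 1. $2\bar g(\bar\nabla_{X^h}Y^h,Z^h)=2m_1\,g(\nabla_XY,Z)+2m_2\,g(\mathfrak{R}(u,X)Y,Z)$; 2. $2\bar g(\bar\nabla_{X^h}Y^h,Z^v)=2m_2\,g(\nabla_XY,Z)-m_3\,g(\mathfrak{R}(X,Y)u,Z)$; 3. $2\bar g(\bar\nabla_{X^h}Y^v,Z^h)=2m_2\,g(\nabla_XY,Z)+m_3\,g(\mathfrak{R}(u,Y)X,Z)$; 4. $2\bar g(\bar\nabla_{X^h}Y^v,Z^v)=2m_3\,g(\nabla_XY,Z)$; 5. $2\bar g(\bar\nabla_{X^v}Y^h,Z^h)=m_3\,g(\mathfrak{R}(u,X)Y,Z)$; 6. $2\bar g(\bar\nabla_{X^v}Y^h,Z^v)=0$; 7. $2\bar g(\bar\nabla_{X^v}Y^v,Z^h)=0$; 8. $2\bar g(\bar\nabla_{X^v}Y^v,Z^v)=0$.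 -/

import Mathlib

open Bundle
open scoped Manifold ContDiff

noncomputable section

namespace TangentLift

variable {E : Type*} [NormedAddCommGroup E] [NormedSpace ℝ E]
  {H : Type*} [TopologicalSpace H] {I : ModelWithCorners ℝ E H}
  {M : Type*} [TopologicalSpace M] [ChartedSpace H M]

/-- A connection `cov` on the tangent bundle of `M` is a *Levi-Civita connection* of the field of
bilinear forms `b` if it maps smooth vector fields to smooth tensor fields, is torsion-free, and
satisfies `v (b(Y, Z)) = b(∇_v Y, Z) + b(Y, ∇_v Z)`.
(In Mathlib's argument order, `cov Y x v` is `∇_v Y` at the point `x`.) -/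
structure IsLeviCivita [FiniteDimensional ℝ E] [IsManifold I ∞ M]
    (cov : CovariantDerivative I E (TangentSpace I : M → Type _))
    (b : ∀ x : M, TangentSpace I x → TangentSpace I x → ℝ) : Prop where
  smooth : CovariantDerivative.ContMDiffCovariantDerivative cov ∞
  torsion_eq_zero : letI := FiniteDimensional.complete ℝ E; cov.torsion = 0
  metric : ∀ (x : M) (v : TangentSpace I x) (Y Z : ∀ y : M, TangentSpace I y),
    MDifferentiableAt I I.tangent (fun y => (⟨y, Y y⟩ : TangentBundle I M)) x →
    MDifferentiableAt I I.tangent (fun y => (⟨y, Z y⟩ : TangentBundle I M)) x →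
    mvfderiv I (fun y => b y (Y y) (Z y)) x v = b x (cov Y x v) (Z x) + b x (Y x) (cov Z x v)

/-- The differential `dπ : T_P(TM) → T_pM` of the projection `π : TM → M` at `P = (p, u)`. -/
def projMap [IsManifold I ∞ M] (P : TangentBundle I M) :
    TangentSpace I.tangent P →L[ℝ] TangentSpace I P.proj :=
  mfderiv I.tangent I (π E (TangentSpace I : M → Type _)) P

/-- The differential at `P = (p, u)` of the fibre coordinate of the standard trivialization of
`TM` at `p`, read back in `T_pM`. -/
def fiberCoordMap [IsManifold I ∞ M] (P : TangentBundle I M) :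
    TangentSpace I.tangent P →L[ℝ] TangentSpace I P.proj :=
  ((trivializationAt E (TangentSpace I : M → Type _) P.proj).symmL ℝ P.proj).comp
    (mvfderiv I.tangent
      (fun Q : TangentBundle I M =>
        (trivializationAt E (TangentSpace I : M → Type _) P.proj Q).2) P)

/-- The connection map `K : T_P(TM) → T_pM` of a connection, at `P = (p, u)`. In coordinates
`(x, y)` of `TM` it is `K(ẋ, ẏ) = ẏ + Γ(ẋ, u)`, where `Γ(ẋ, u)` is the covariant derivative in
direction `ẋ` of the local field with constant components `u`. It is the map characterized by
`K (dσ(v)) = ∇_v σ` for vector fields `σ` on `M`, see `connectionMap_mfderiv` below. -/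
def connectionMap [IsManifold I ∞ M]
    (cov : CovariantDerivative I E (TangentSpace I : M → Type _)) (P : TangentBundle I M) :
    TangentSpace I.tangent P →L[ℝ] TangentSpace I P.proj :=
  fiberCoordMap P + (cov (FiberBundle.extend E P.snd) P.proj).comp (projMap P)

theorem bijective_symmL [IsManifold I ∞ M] (p : M) : Function.Bijective
    ((trivializationAt E (TangentSpace I : M → Type _) p).symmL ℝ p) := by
  have h := FiberBundle.mem_baseSet_trivializationAt' (F := E)
    (E := (TangentSpace I : M → Type _)) p
  rw [← Trivialization.symm_continuousLinearEquivAt_eq _ h]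
  exact ContinuousLinearEquiv.bijective _

theorem mdifferentiableAt_fiberCoord [IsManifold I ∞ M] (P : TangentBundle I M) :
    MDifferentiableAt I.tangent 𝓘(ℝ, E)
      (fun Q => (trivializationAt E (TangentSpace I : M → Type _) P.proj Q).2) P := by
  let e := trivializationAt E (TangentSpace I : M → Type _) P.proj
  have hP : P ∈ e.source := FiberBundle.mem_trivializationAt_proj_source
  have he : MDifferentiableAt I.tangent (I.prod 𝓘(ℝ, E)) e P :=
    ((e.contMDiffOn (n := 1)).mdifferentiableOn one_ne_zero).mdifferentiableAt
      (e.open_source.mem_nhds hP)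
  exact MDifferentiableAt.comp P (mdifferentiableAt_snd (x := e P)) he

theorem bijective_projMap_fiberCoordMap [IsManifold I ∞ M] (P : TangentBundle I M) :
    Function.Bijective (fun ξ => (projMap P ξ, fiberCoordMap P ξ)) := by
  have hS := bijective_symmL (I := I) P.proj
  let e := trivializationAt E (TangentSpace I : M → Type _) P.proj
  have hP : P ∈ e.source := FiberBundle.mem_trivializationAt_proj_source
  have hmd : e.toOpenPartialHomeomorph.MDifferentiable I.tangent (I.prod 𝓘(ℝ, E)) :=
    ⟨(e.contMDiffOn (n := 1)).mdifferentiableOn one_ne_zero,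
     (e.contMDiffOn_symm (n := 1)).mdifferentiableOn one_ne_zero⟩
  have hb := hmd.mfderiv_bijective hP
  have he : HasMFDerivAt I.tangent (I.prod 𝓘(ℝ, E)) e P
    (mfderiv I.tangent (I.prod 𝓘(ℝ, E)) e P) := (hmd.mdifferentiableAt hP).hasMFDerivAt
  have hev : (π E (TangentSpace I : M → Type _)) =ᶠ[nhds P] fun Q => (e Q).1 := by
    filter_upwards [e.open_source.mem_nhds hP] with Q hQ using (e.coe_fst hQ).symm
  have h1 : projMap P = (ContinuousLinearMap.fst ℝ E E).comp
      (mfderiv I.tangent (I.prod 𝓘(ℝ, E)) e P) :=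
    (HasMFDerivAt.congr_of_eventuallyEq
      (HasMFDerivAt.comp P (hasMFDerivAt_fst (x := e P)) he) hev).mfderiv
  have h2 : mfderiv I.tangent 𝓘(ℝ, E) (fun Q => (e Q).2) P = (ContinuousLinearMap.snd ℝ E E).comp
      (mfderiv I.tangent (I.prod 𝓘(ℝ, E)) e P) :=
    (HasMFDerivAt.comp P (hasMFDerivAt_snd (x := e P)) he).mfderiv
  have h2' : ∀ ξ, mvfderiv I.tangent (fun Q => (e Q).2) P ξ =
    (mfderiv I.tangent (I.prod 𝓘(ℝ, E)) e P ξ).2 := fun ξ => congr($h2 ξ)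
  have h1' : ∀ ξ, projMap P ξ = (mfderiv I.tangent (I.prod 𝓘(ℝ, E)) e P ξ).1 :=
    fun ξ => congr($h1 ξ)
  have hb2 : Function.Bijective (fun ξ : TangentSpace I.tangent P =>
      ((mfderiv I.tangent (I.prod 𝓘(ℝ, E)) e P ξ : E × E))) := hb
  have h3 := ((Function.bijective_id (α := E)).prodMap hS).comp hb2
  have h4 : ∀ ξ, (projMap P ξ, fiberCoordMap P ξ) =
      (Prod.map id (e.symmL ℝ P.proj) ∘ fun ξ : TangentSpace I.tangent P =>
        (mfderiv I.tangent (I.prod 𝓘(ℝ, E)) e P ξ : E × E)) ξ := fun ξ =>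
    Prod.ext (h1' ξ) (congrArg (e.symmL ℝ P.proj) (h2' ξ))
  exact (funext h4) ▸ h3

/-- A tangent vector of `TM` at `P` is determined by its images under `dπ` and `K`, which can be
prescribed arbitrarily: `T_P(TM)` is the direct sum of `ker K` and `ker dπ`. -/
theorem bijective_projMap_connectionMap [IsManifold I ∞ M]
    (cov : CovariantDerivative I E (TangentSpace I : M → Type _)) (P : TangentBundle I M) :
    Function.Bijective
      ((projMap P).toLinearMap.prod (connectionMap cov P).toLinearMap) := by
  obtain ⟨hi, hs⟩ := bijective_projMap_fiberCoordMap P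
  have key : ∀ ξ, connectionMap cov P ξ =
      fiberCoordMap P ξ + cov (FiberBundle.extend E P.snd) P.proj (projMap P ξ) := fun _ => rfl
  refine ⟨fun ξ η h => hi ?_, fun ⟨a, c⟩ => ?_⟩
  · have h1 : projMap P ξ = projMap P η := congrArg Prod.fst h
    have h2 : connectionMap cov P ξ = connectionMap cov P η := congrArg Prod.snd h
    rw [key, key, h1, add_left_inj] at h2
    exact Prod.ext h1 h2
  · obtain ⟨ξ, h⟩ := hs (a, c - cov (FiberBundle.extend E P.snd) P.proj a)
    have h1 : projMap P ξ = a := congrArg Prod.fst h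
    have h2 : fiberCoordMap P ξ = _ := congrArg Prod.snd h
    refine ⟨ξ, Prod.ext h1 ?_⟩
    change connectionMap cov P ξ = c
    rw [key, h1, h2, sub_add_cancel]

/-- The characterizing property `K (dσ(v)) = ∇_v σ` of the connection map. -/
theorem connectionMap_mfderiv [FiniteDimensional ℝ E] [IsManifold I ∞ M]
    (cov : CovariantDerivative I E (TangentSpace I : M → Type _))
    (σ : ∀ y : M, TangentSpace I y) (x : M)
    (hσ : MDifferentiableAt I I.tangent (fun y => (⟨y, σ y⟩ : TangentBundle I M)) x)
    (v : TangentSpace I x) :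
    connectionMap cov (⟨x, σ x⟩ : TangentBundle I M)
      (mfderiv I I.tangent (fun y => (⟨y, σ y⟩ : TangentBundle I M)) x v) = cov σ x v := by
  let e := trivializationAt E (TangentSpace I : M → Type _) x
  have hx : x ∈ e.baseSet := FiberBundle.mem_baseSet_trivializationAt' x
  have hsec : ∀ {τ : ∀ y : M, TangentSpace I y},
      MDifferentiableAt I I.tangent (fun y => (⟨y, τ y⟩ : TangentBundle I M)) x →
      MDifferentiableAt I 𝓘(ℝ, E) (fun y => (e ⟨y, τ y⟩).2) x := fun h =>
    (mdifferentiableAt_section (F := E) _ _).1 h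
  have hself : ∀ w : TangentSpace I x, e.symmL ℝ x (e ⟨x, w⟩).2 = w := fun w => by
    rw [← Trivialization.symm_continuousLinearEquivAt_eq e hx]
    exact (e.continuousLinearEquivAt ℝ x hx).symm_apply_apply w
  have hcongr : ∀ {f f' : M → E}, f =ᶠ[nhds x] f' → mvfderiv I f x v = mvfderiv I f' x v :=
    fun h => congr($(h.mfderiv_eq (I := I) (I' := 𝓘(ℝ, E))) v)
  let Φ : (∀ y : M, TangentSpace I y) → TangentSpace I x := fun τ =>
    cov τ x v - e.symmL ℝ x (mvfderiv I (fun y => (e ⟨y, τ y⟩).2) x v)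
  have hΦ : TensorialAt I E Φ x := by
    constructor
    · intro f τ hf hτ
      have : (fun y => (e ⟨y, (f • τ) y⟩).2) =ᶠ[nhds x] f • fun y => (e ⟨y, τ y⟩).2 := by
        filter_upwards [e.open_baseSet.mem_nhds hx] with y hy
        exact (e.linear ℝ hy).map_smul (f y) (τ y)
      simp only [Φ, cov.isCovariantDerivativeOn.leibniz hτ hf, hcongr this,
        mvfderiv_smul hf (hsec hτ)]
      simp [hself, smul_sub]
    · intro τ τ' hτ hτ'
      have : (fun y => (e ⟨y, (τ + τ') y⟩).2) =ᶠ[nhds x]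
          (fun y => (e ⟨y, τ y⟩).2) + fun y => (e ⟨y, τ' y⟩).2 := by
        filter_upwards [e.open_baseSet.mem_nhds hx] with y hy
        exact (e.linear ℝ hy).map_add (τ y) (τ' y)
      simp only [Φ, cov.isCovariantDerivativeOn.add hτ hτ', hcongr this,
        mvfderiv_add (hsec hτ) (hsec hτ')]
      simp
      abel
  have hext : MDifferentiableAt I I.tangent
      (fun y => (⟨y, FiberBundle.extend E (σ x) y⟩ : TangentBundle I M)) x :=
    FiberBundle.mdifferentiableAt_extend ..
  have h := hΦ.pointwise hσ hext (by simp)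
  have h0 : mvfderiv I (fun y => (e ⟨y, FiberBundle.extend E (σ x) y⟩).2) x v = 0 := by
    have : (fun y => (e ⟨y, FiberBundle.extend E (σ x) y⟩).2) =ᶠ[nhds x]
        fun _ => (e ⟨x, σ x⟩).2 := by
      filter_upwards [e.open_baseSet.mem_nhds hx] with y hy
      have h4 := congrArg Prod.snd (e.apply_mk_symm hy (e ⟨x, σ x⟩).2)
      exact h4
    rw [hcongr this, mvfderiv_const]
    rfl
  have h1 : projMap (⟨x, σ x⟩ : TangentBundle I M)
      (mfderiv I I.tangent (fun y => (⟨y, σ y⟩ : TangentBundle I M)) x v) = v := by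
    have h3 := (mdifferentiableAt_proj (IB := I) (F := E) (TangentSpace I : M → Type _)
      (p := ⟨x, σ x⟩)).hasMFDerivAt.comp x hσ.hasMFDerivAt
    exact congr($(hasMFDerivAt_unique h3 (hasMFDerivAt_id x)) v)
  have h2 : fiberCoordMap (⟨x, σ x⟩ : TangentBundle I M)
      (mfderiv I I.tangent (fun y => (⟨y, σ y⟩ : TangentBundle I M)) x v) =
      e.symmL ℝ x (mvfderiv I (fun y => (e ⟨y, σ y⟩).2) x v) := by
    have hd := mdifferentiableAt_fiberCoord (⟨x, σ x⟩ : TangentBundle I M)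
    have h4 := congr($(mfderiv_comp x hd hσ) v)
    exact congrArg (e.symmL ℝ x) h4.symm
  change fiberCoordMap _ _ + cov (FiberBundle.extend E (σ x)) x (projMap _ _) = _
  rw [h1, h2]
  simp only [Φ, h0, map_zero, sub_zero] at h
  rw [← h, add_sub_cancel]

/-- The isomorphism `(dπ, K) : T_P(TM) ≃ T_pM × T_pM`. -/
def splitting [IsManifold I ∞ M]
    (cov : CovariantDerivative I E (TangentSpace I : M → Type _)) (P : TangentBundle I M) :
    TangentSpace I.tangent P ≃ₗ[ℝ] TangentSpace I P.proj × TangentSpace I P.proj :=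
  LinearEquiv.ofBijective _ (bijective_projMap_connectionMap cov P)

/-- The horizontal lift of a vector field `X` on `M`: the vector field `Xʰ` on `TM` with
`dπ(Xʰ) = X` and `K(Xʰ) = 0`. -/
def hLift [IsManifold I ∞ M] (cov : CovariantDerivative I E (TangentSpace I : M → Type _))
    (X : ∀ x : M, TangentSpace I x) (P : TangentBundle I M) : TangentSpace I.tangent P :=
  (splitting cov P).symm (X P.proj, 0)

/-- The vertical lift of a vector field `X` on `M`: the vector field `Xᵛ` on `TM` with
`dπ(Xᵛ) = 0` and `K(Xᵛ) = X`. -/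
def vLift [IsManifold I ∞ M] (cov : CovariantDerivative I E (TangentSpace I : M → Type _))
    (X : ∀ x : M, TangentSpace I x) (P : TangentBundle I M) : TangentSpace I.tangent P :=
  (splitting cov P).symm (0, X P.proj)

section lifts

variable [IsManifold I ∞ M] (cov : CovariantDerivative I E (TangentSpace I : M → Type _))
  (X Y : ∀ x : M, TangentSpace I x) (P : TangentBundle I M)

theorem projMap_hLift : projMap P (hLift cov X P) = X P.proj :=
  congrArg Prod.fst ((splitting cov P).apply_symm_apply (X P.proj, 0))

theorem connectionMap_hLift : connectionMap cov P (hLift cov X P) = 0 :=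
  congrArg Prod.snd ((splitting cov P).apply_symm_apply (X P.proj, 0))

theorem projMap_vLift : projMap P (vLift cov X P) = 0 :=
  congrArg Prod.fst ((splitting cov P).apply_symm_apply (0, X P.proj))

theorem connectionMap_vLift : connectionMap cov P (vLift cov X P) = X P.proj :=
  congrArg Prod.snd ((splitting cov P).apply_symm_apply (0, X P.proj))

end lifts

/-- The field of bilinear forms
`m₁ g(dπ ·, dπ ·) + m₂ (g(dπ ·, K ·) + g(K ·, dπ ·)) + m₃ g(K ·, K ·)` on `TM`, that is, the one
with `ḡ(Xʰ, Yʰ) = m₁ g(X, Y)`, `ḡ(Xʰ, Yᵛ) = m₂ g(X, Y)`, `ḡ(Xᵛ, Yᵛ) = m₃ g(X, Y)`. -/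
def liftMetric [IsManifold I ∞ M]
    (g : ContMDiffRiemannianMetric I ∞ E (TangentSpace I : M → Type _))
    (cov : CovariantDerivative I E (TangentSpace I : M → Type _)) (m₁ m₂ m₃ : ℝ)
    (P : TangentBundle I M) (ξ η : TangentSpace I.tangent P) : ℝ :=
  m₁ * g.inner P.proj (projMap P ξ) (projMap P η) +
  m₂ * (g.inner P.proj (projMap P ξ) (connectionMap cov P η) +
    g.inner P.proj (connectionMap cov P ξ) (projMap P η)) +
  m₃ * g.inner P.proj (connectionMap cov P ξ) (connectionMap cov P η)

section liftMetric

variable [IsManifold I ∞ M] (g : ContMDiffRiemannianMetric I ∞ E (TangentSpace I : M → Type _))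
  (cov : CovariantDerivative I E (TangentSpace I : M → Type _)) (m₁ m₂ m₃ : ℝ)
  (X Y : ∀ x : M, TangentSpace I x) (P : TangentBundle I M)

theorem liftMetric_hLift_hLift :
    liftMetric g cov m₁ m₂ m₃ P (hLift cov X P) (hLift cov Y P) =
      m₁ * g.inner P.proj (X P.proj) (Y P.proj) := by
  simp [liftMetric, projMap_hLift, connectionMap_hLift]

theorem liftMetric_hLift_vLift :
    liftMetric g cov m₁ m₂ m₃ P (hLift cov X P) (vLift cov Y P) =
      m₂ * g.inner P.proj (X P.proj) (Y P.proj) := by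
  simp [liftMetric, projMap_hLift, connectionMap_hLift, projMap_vLift, connectionMap_vLift]

theorem liftMetric_vLift_vLift :
    liftMetric g cov m₁ m₂ m₃ P (vLift cov X P) (vLift cov Y P) =
      m₃ * g.inner P.proj (X P.proj) (Y P.proj) := by
  simp [liftMetric, projMap_vLift, connectionMap_vLift]

end liftMetric

/-- The curvature `∇_X ∇_Y Z - ∇_Y ∇_X Z - ∇_[X,Y] Z` of a connection, on vector fields. -/
def curvatureField [IsManifold I ∞ M]
    (cov : CovariantDerivative I E (TangentSpace I : M → Type _))
    (X Y Z : ∀ x : M, TangentSpace I x) (x : M) : TangentSpace I x :=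
  cov (fun y => cov Z y (Y y)) x (X x) - cov (fun y => cov Z y (X y)) x (Y x) -
    cov Z x (VectorField.mlieBracket I X Y x)

/-- The curvature tensor `R(a, b)c` at `x`, computed on the local smooth extensions of the three
tangent vectors that have constant components in the standard trivialization at `x`. -/
def curvature [IsManifold I ∞ M] (cov : CovariantDerivative I E (TangentSpace I : M → Type _))
    (x : M) (a b c : TangentSpace I x) : TangentSpace I x :=
  curvatureField cov (FiberBundle.extend E a) (FiberBundle.extend E b) (FiberBundle.extend E c) x

end TangentLift

end

set_option linter.unusedSectionVars false

open VectorField Filter Topology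

/-! The identities follow from the Koszul formula on `TM`, once brackets of lifts are known. Put `A
= X₁ʰ + Y₁ᵛ` and `B = X₂ʰ + Y₂ᵛ`. Then `dπ[A, B] = [X₁, X₂]` and `K[A, B] = ∇_{X₁}Y₂ - ∇_{X₂}Y₁ -
R(X₁, X₂)u`; curvature enters only through this last term. The functions `ḡ(A, B)` are pulled back
from `M`, so they are differentiated by metric compatibility of `∇`.

Both bracket formulas are read off by letting `[A, B]` act on functions as a commutator
(`mvfderiv_mlieBracket`). Pull-backs `f ∘ π` give the `dπ` part. The fibrewise linear functions
`F_W(u) = g(u, W)` give the `K` part, because `ξ F_W = g(K ξ, W) + g(u, ∇_{dπ ξ} W)`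
(`mvfderiv_fiberInner`); hence `A F_W = g(Y₁, W) ∘ π + F_{∇_{X₁} W}` is again a sum of test
functions.

Two supporting facts are needed. Lifts of smooth fields are smooth
(`contMDiff_of_projMap_of_connectionMap`), although `K` at each point is defined by a trivialization
centred there. The curvature is tensorial and has its classical symmetries, which collect the Koszul
terms into one formula for arbitrary sums of lifts (`IsLift.liftMetric_cov`). The eight identities
are the cases where each field is purely horizontal or purely vertical. -/

namespace TangentLift

/-! ### Lie brackets as commutators of derivations -/

section Commutator

variable {E : Type*} [NormedAddCommGroup E] [NormedSpace ℝ E] [FiniteDimensional ℝ E]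
  {H : Type*} [TopologicalSpace H] {I : ModelWithCorners ℝ E H}
  {M : Type*} [TopologicalSpace M] [ChartedSpace H M] [IsManifold I ∞ M]

theorem mvfderiv_congr {F : Type*} [NormedAddCommGroup F] [NormedSpace ℝ F] {f f' : M → F} {x : M}
    (h : f =ᶠ[𝓝 x] f') (v : TangentSpace I x) : mvfderiv I f x v = mvfderiv I f' x v :=
  congr($(h.mfderiv_eq (I := I) (I' := 𝓘(ℝ, F))) v)

/-- The Lie bracket of vector fields is their commutator as derivations. -/
theorem mvfderiv_mlieBracket {V W : ∀ x : M, TangentSpace I x} {f : M → ℝ} {x : M}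
    (hV : CMDiffAt 2 (T% V) x) (hW : CMDiffAt 2 (T% W) x) (hf : CMDiffAt 2 f x)
    (hVf : MDiffAt (fun y => mvfderiv I f y (V y)) x)
    (hWf : MDiffAt (fun y => mvfderiv I f y (W y)) x) :
    mvfderiv I f x (mlieBracket I V W x) =
      mvfderiv I (fun y => mvfderiv I f y (W y)) x (V x) -
        mvfderiv I (fun y => mvfderiv I f y (V y)) x (W x) := by
  have : CompleteSpace E := FiniteDimensional.complete ℝ E
  have : IsManifold I (minSmoothness ℝ 3) M := by
    rw [minSmoothness_of_isRCLikeNormedField]; infer_instance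
  have : IsManifold I (((2 : ℕ∞) : ℕ∞ω) + 1) M :=
    IsManifold.of_le (n := ∞) (by exact_mod_cast (le_top : (3 : ℕ∞) ≤ ⊤))
  have hms : minSmoothness ℝ 2 = 2 := minSmoothness_of_isRCLikeNormedField
  -- The argument ends by cancelling a nonzero tangent vector, so dimension zero is settled
  -- separately.
  rcases subsingleton_or_nontrivial E with hE | hE
  · have h0 : ∀ v : TangentSpace I x, v = 0 := fun v => Subsingleton.elim (α := E) v 0
    simp [h0 (V x), h0 (W x), h0 (mlieBracket I V W x)]
  obtain ⟨u, hu⟩ : ∃ u : TangentSpace I x, u ≠ 0 := exists_ne (α := E) 0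
  set U : ∀ y : M, TangentSpace I y := FiberBundle.extend E u with hUdef
  have hUx : U x = u := FiberBundle.extend_apply_self ..
  have hU : CMDiffAt 2 (T% U) x := FiberBundle.contMDiffAt_extend ..
  have hfU : CMDiffAt 2 (T% (f • U)) x := hf.smul_section hU
  have ev : ∀ {S : ∀ y : M, TangentSpace I y}, CMDiffAt 2 (T% S) x →
      ∀ᶠ y in 𝓝 x, MDiffAt (T% S) y :=
    fun h => ((contMDiffAt_iff_contMDiffAt_nhds (by simp)).1 h).mono
      fun y hy => hy.mdifferentiableAt two_ne_zero
  have evf : ∀ᶠ y in 𝓝 x, MDiffAt f y := ((contMDiffAt_iff_contMDiffAt_nhds (by simp)).1 hf).mono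
      fun y hy => hy.mdifferentiableAt two_ne_zero
  have br : ∀ {S S' : ∀ y : M, TangentSpace I y}, CMDiffAt 2 (T% S) x → CMDiffAt 2 (T% S') x →
      MDiffAt (T% (mlieBracket I S S')) x := fun {S S'} h h' =>
    (ContMDiffAt.mlieBracket_vectorField (m := 1) (n := 2) h h' (by
      rw [minSmoothness_of_isRCLikeNormedField]; norm_num)).mdifferentiableAt one_ne_zero
  have md : ∀ {S : ∀ y : M, TangentSpace I y}, CMDiffAt 2 (T% S) x → MDiffAt (T% S) x :=
    fun h => h.mdifferentiableAt two_ne_zero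
  have hfx : MDiffAt f x := hf.mdifferentiableAt two_ne_zero
  have expand : ∀ {S : ∀ y : M, TangentSpace I y},
      mlieBracket I S (f • U) =ᶠ[𝓝 x]
        (fun y => mvfderiv I f y (S y)) • U + f • mlieBracket I S U := by
    intro S
    filter_upwards [evf, ev hU] with y h1 h2
    exact mlieBracket_smul_right h1 h2
  have nested : ∀ {S S' : ∀ y : M, TangentSpace I y}, CMDiffAt 2 (T% S') x →
      MDiffAt (fun y => mvfderiv I f y (S' y)) x →
      mlieBracket I S (mlieBracket I S' (f • U)) x =
        mvfderiv I (fun y => mvfderiv I f y (S' y)) x (S x) • U x +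
          mvfderiv I f x (S' x) • mlieBracket I S U x +
          (mvfderiv I f x (S x) • mlieBracket I S' U x +
            f x • mlieBracket I S (mlieBracket I S' U) x) := by
    intro S S' hS' hd
    rw [(EventuallyEq.refl _ S).mlieBracket_vectorField_eq expand,
      mlieBracket_add_right (MDifferentiableAt.smul_section hd (md hU))
        (MDifferentiableAt.smul_section hfx (br hS' hU)),
      mlieBracket_smul_right hd (md hU), mlieBracket_smul_right hfx (br hS' hU)]
  -- Compare the Jacobi identity for `V, W, fU` with `f` times the one for `V, W, U`. The terms with
  -- first derivatives of `f` along `V` and `W` cancel, leaving `([V, W]f - V(Wf) + W(Vf)) U = 0` at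
  -- `x`.
  have J1 := leibniz_identity_mlieBracket_apply (I := I) (hms ▸ hV) (hms ▸ hW) (hms ▸ hfU)
  have J2 := leibniz_identity_mlieBracket_apply (I := I) (hms ▸ hV) (hms ▸ hW) (hms ▸ hU)
  rw [nested hW hWf, nested hV hVf, mlieBracket_smul_right hfx (md hU), J2] at J1
  have key : (mvfderiv I f x (mlieBracket I V W x) -
      (mvfderiv I (fun y => mvfderiv I f y (W y)) x (V x) -
        mvfderiv I (fun y => mvfderiv I f y (V y)) x (W x))) • u = 0 := by
    refine neg_eq_zero.1 (Eq.trans ?_ (sub_eq_zero.2 J1))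
    rw [hUx]
    module
  exact sub_eq_zero.1 ((smul_eq_zero.1 key).resolve_right hu)

end Commutator

/-! ### Globalizing germs of vector fields -/

section Extension

variable {E : Type*} [NormedAddCommGroup E] [NormedSpace ℝ E] [FiniteDimensional ℝ E]
  {H : Type*} [TopologicalSpace H] {I : ModelWithCorners ℝ E H}
  {M : Type*} [TopologicalSpace M] [ChartedSpace H M] [T2Space M] [IsManifold I ∞ M]

/-- A vector field which is smooth near a point agrees near that point with a smooth one. -/
theorem exists_contMDiff_eventuallyEq {σ : ∀ x : M, TangentSpace I x} {p : M} {s : Set M}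
    (hs : s ∈ 𝓝 p) (hσ : CMDiff[s] ∞ (T% σ)) :
    ∃ τ : ∀ x : M, TangentSpace I x, CMDiff ∞ (T% τ) ∧ τ =ᶠ[𝓝 p] σ := by
  obtain ⟨f, -, hf⟩ := (SmoothBumpFunction.nhds_basis_tsupport (I := I) p).mem_iff.1
    (interior_mem_nhds.2 hs)
  refine ⟨⇑f • σ, f.contMDiff.contMDiffOn.smul_section_of_tsupport isOpen_interior hf
    (hσ.mono interior_subset), ?_⟩
  filter_upwards [f.eventuallyEq_one] with y hy
  change f y • σ y = σ y
  rw [hy, Pi.one_apply, one_smul]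

/-- Every tangent vector extends to a smooth vector field, which near the base point has constant
components in the standard trivialization. -/
theorem exists_contMDiff_eventuallyEq_extend {p : M} (w : TangentSpace I p) :
    ∃ τ : ∀ x : M, TangentSpace I x, CMDiff ∞ (T% τ) ∧
      τ =ᶠ[𝓝 p] FiberBundle.extend E (E := (TangentSpace I : M → Type _)) w := by
  obtain ⟨s, hs, h⟩ := FiberBundle.exists_contMDiffOn_extend (k := ∞) I E w
  exact exists_contMDiff_eventuallyEq hs h

theorem exists_contMDiff_apply_eq {p : M} (w : TangentSpace I p) :
    ∃ τ : ∀ x : M, TangentSpace I x, CMDiff ∞ (T% τ) ∧ τ p = w := by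
  obtain ⟨τ, h, h'⟩ := exists_contMDiff_eventuallyEq_extend w
  exact ⟨τ, h, h'.self_of_nhds.trans (FiberBundle.extend_apply_self ..)⟩

end Extension

/-! ### Smooth functions on the base and on the tangent bundle -/

section Smoothness

variable {E : Type*} [NormedAddCommGroup E] [NormedSpace ℝ E]
  {H : Type*} [TopologicalSpace H] {I : ModelWithCorners ℝ E H}
  {M : Type*} [TopologicalSpace M] [ChartedSpace H M] [IsManifold I ∞ M]
  {E' : Type*} [NormedAddCommGroup E'] [NormedSpace ℝ E']
  {H' : Type*} [TopologicalSpace H'] {I' : ModelWithCorners ℝ E' H'}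
  {N : Type*} [TopologicalSpace N] [ChartedSpace H' N]
  {g : ContMDiffRiemannianMetric I ∞ E (TangentSpace I : M → Type _)}
  {cov : CovariantDerivative I E (TangentSpace I : M → Type _)}
  {X Y Z W : ∀ x : M, TangentSpace I x}

/-- The metric is smooth on pairs of smooth vector fields along a map. -/
theorem contMDiff_inner_along {b : N → M} {v w : ∀ y, TangentSpace I (b y)}
    (hv : ContMDiff I' I.tangent ∞ (fun y => (⟨b y, v y⟩ : TangentBundle I M)))
    (hw : ContMDiff I' I.tangent ∞ (fun y => (⟨b y, w y⟩ : TangentBundle I M))) :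
    ContMDiff I' 𝓘(ℝ) ∞ (fun y => g.inner (b y) (v y) (w y)) := by
  intro y
  have hb : ContMDiffAt I' I ∞ b y := (contMDiffAt_totalSpace.1 (hv y)).1
  have : ContMDiffAt I' (I.prod 𝓘(ℝ)) ∞
      (fun y => TotalSpace.mk' ℝ (E := Bundle.Trivial M ℝ) (b y) (g.inner (b y) (v y) (w y))) y :=
    ContMDiffAt.clm_bundle_apply₂ (F₁ := E) (F₂ := E)
      (ContMDiffAt.comp y g.contMDiff.contMDiffAt hb) (hv y) (hw y)
  exact (contMDiffAt_totalSpace.1 this).2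

theorem contMDiff_inner (hY : CMDiff ∞ (T% Y)) (hZ : CMDiff ∞ (T% Z)) :
    ContMDiff I 𝓘(ℝ) ∞ (fun x => g.inner x (Y x) (Z x)) :=
  contMDiff_inner_along (b := fun x : M => x) hY hZ

theorem contMDiff_proj : ContMDiff I.tangent I ∞ (fun Q : TangentBundle I M => Q.proj) :=
  Bundle.contMDiff_proj _

/-- The tautological section `u` along `π` is the identity map of `TM`. These functions, together
with pull-backs from `M`, serve as test functions for vector fields on `TM`. -/
theorem contMDiff_fiberInner (hW : CMDiff ∞ (T% W)) :
    ContMDiff I.tangent 𝓘(ℝ) ∞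
      (fun Q : TangentBundle I M => g.inner Q.proj Q.snd (W Q.proj)) :=
  contMDiff_inner_along (b := fun Q : TangentBundle I M => Q.proj) contMDiff_id
    (hW.comp contMDiff_proj)

theorem contMDiff_cov (hc : CovariantDerivative.ContMDiffCovariantDerivative cov ∞)
    (hX : CMDiff ∞ (T% X)) (hY : CMDiff ∞ (T% Y)) : CMDiff ∞ (T% fun x => cov Y x (X x)) :=
  ContMDiff.clm_bundle_apply (b := fun x : M => x)
    (contMDiffOn_univ.1 (hc.contMDiff.contMDiff (contMDiffOn_univ.2 hY))) hX

theorem contMDiff_zero : CMDiff ∞ (T% (0 : ∀ x : M, TangentSpace I x)) :=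
  contMDiff_zeroSection ℝ (TangentSpace I : M → Type _)

theorem mdiffAt_of_contMDiff (h : CMDiff ∞ (T% X)) (x : M) : MDiffAt (T% X) x :=
  (h x).mdifferentiableAt (by simp)

theorem mvfderiv_comp_proj {f : M → ℝ} {Q : TangentBundle I M} (hf : MDiffAt f Q.proj)
    (ξ : TangentSpace I.tangent Q) :
    mvfderiv I.tangent (fun Q : TangentBundle I M => f Q.proj) Q ξ =
      mvfderiv I f Q.proj (projMap Q ξ) :=
  mvfderiv_comp_apply Q hf (mdifferentiableAt_proj (TangentSpace I : M → Type _)) ξ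

end Smoothness

/-! ### The connection map through derivatives of fibrewise linear functions -/

section FiberDerivative

variable {E : Type*} [NormedAddCommGroup E] [NormedSpace ℝ E] [FiniteDimensional ℝ E]
  {H : Type*} [TopologicalSpace H] {I : ModelWithCorners ℝ E H}
  {M : Type*} [TopologicalSpace M] [ChartedSpace H M] [IsManifold I ∞ M]
  {g : ContMDiffRiemannianMetric I ∞ E (TangentSpace I : M → Type _)}
  {cov : CovariantDerivative I E (TangentSpace I : M → Type _)}
  {X Y Z W : ∀ x : M, TangentSpace I x}

theorem mdifferentiableAt_trivializationAt (p₀ : M) {Q : TangentBundle I M}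
    (hQ : Q.proj ∈ (trivializationAt E (TangentSpace I : M → Type _) p₀).baseSet) :
    MDifferentiableAt I.tangent (I.prod 𝓘(ℝ, E))
      (trivializationAt E (TangentSpace I : M → Type _) p₀) Q := by
  let e := trivializationAt E (TangentSpace I : M → Type _) p₀
  have hQ' : Q ∈ e.source := e.mem_source.2 hQ
  exact ((e.contMDiffOn (n := 1)).mdifferentiableOn one_ne_zero).mdifferentiableAt
      (e.open_source.mem_nhds hQ')

theorem mfderiv_trivializationAt (p₀ : M) {Q : TangentBundle I M}
    (hQ : Q.proj ∈ (trivializationAt E (TangentSpace I : M → Type _) p₀).baseSet)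
    (ξ : TangentSpace I.tangent Q) :
    mfderiv I.tangent (I.prod 𝓘(ℝ, E)) (trivializationAt E (TangentSpace I : M → Type _) p₀) Q ξ =
      ((projMap Q ξ, mvfderiv I.tangent
        (fun Q' => (trivializationAt E (TangentSpace I : M → Type _) p₀ Q').2) Q ξ) : E × E) := by
  have he := (mdifferentiableAt_trivializationAt p₀ hQ).hasMFDerivAt
  let e := trivializationAt E (TangentSpace I : M → Type _) p₀
  have hev : (π E (TangentSpace I : M → Type _)) =ᶠ[nhds Q] fun Q => (e Q).1 := by
    filter_upwards [e.open_source.mem_nhds (e.mem_source.2 hQ)] with Q hQ using (e.coe_fst hQ).symm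
  have h1 := (HasMFDerivAt.congr_of_eventuallyEq
      (HasMFDerivAt.comp Q (hasMFDerivAt_fst (x := e Q)) he) hev).mfderiv
  have h2 := (HasMFDerivAt.comp Q (hasMFDerivAt_snd (x := e Q)) he).mfderiv
  exact Prod.ext congr($h1 ξ).symm congr($h2 ξ).symm

/-- In the product `M × E` the derivative splits. The base part freezes the fibre coordinate and is
metric compatibility for the field with constant components through `Q`. The fibre part
differentiates a linear function. The centre `p₀` is kept independent of `Q` so that two
trivializations can be compared. -/
theorem mvfderiv_fiberInner_trivialization
    (hcov : IsLeviCivita cov (fun x v w => g.inner x v w)) (hW : CMDiff ∞ (T% W)) (p₀ : M)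
    {Q : TangentBundle I M}
    (hQ : Q.proj ∈ (trivializationAt E (TangentSpace I : M → Type _) p₀).baseSet)
    (ξ : TangentSpace I.tangent Q) :
    mvfderiv I.tangent (fun Q : TangentBundle I M => g.inner Q.proj Q.snd (W Q.proj)) Q ξ =
      g.inner Q.proj
        ((trivializationAt E (TangentSpace I : M → Type _) p₀).symmL ℝ Q.proj
          (mvfderiv I.tangent
            (fun Q' => (trivializationAt E (TangentSpace I : M → Type _) p₀ Q').2) Q ξ) +
          cov (fun x => (trivializationAt E (TangentSpace I : M → Type _) p₀).symm x
            (trivializationAt E (TangentSpace I : M → Type _) p₀ Q).2) Q.proj (projMap Q ξ))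
        (W Q.proj) +
      g.inner Q.proj Q.snd (cov W Q.proj (projMap Q ξ)) := by
  set e := trivializationAt E (TangentSpace I : M → Type _) p₀ with he_def
  have hQ' : Q ∈ e.source := e.mem_source.2 hQ
  have heQ := mdifferentiableAt_trivializationAt p₀ hQ
  let G : M × E → ℝ := fun z => g.inner z.1 (e.symm z.1 z.2) (W z.1)
  have hev : (fun Q : TangentBundle I M => g.inner Q.proj Q.snd (W Q.proj)) =ᶠ[nhds Q] G ∘ e := by
    filter_upwards [e.open_source.mem_nhds hQ'] with R hR
    have h1 : e.symm R.proj (e R).2 = R.snd := e.symm_apply_apply_mk (e.mem_source.1 hR) R.snd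
    change _ = g.inner R.proj (e.symm R.proj (e R).2) (W R.proj)
    rw [h1]
  have hsymm : MDifferentiableAt (I.prod 𝓘(ℝ, E)) I.tangent
      (fun z : M × E => (⟨z.1, e.symm z.1 z.2⟩ : TangentBundle I M)) (e Q) := by
    have h1 : MDifferentiableAt (I.prod 𝓘(ℝ, E)) I.tangent e.toOpenPartialHomeomorph.symm (e Q) :=
      ((e.contMDiffOn_symm (n := 1)).mdifferentiableOn one_ne_zero).mdifferentiableAt
        (e.open_target.mem_nhds (e.map_source hQ'))
    refine h1.congr_of_eventuallyEq ?_
    filter_upwards [e.open_target.mem_nhds (e.map_source hQ')] with z hz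
    exact e.mk_symm (e.mem_target.1 hz) z.2
  have hG : MDifferentiableAt (I.prod 𝓘(ℝ, E)) 𝓘(ℝ) G (e Q) := by
    exact MDifferentiableAt.comp (e Q)
      (g := fun Q : TangentBundle I M => g.inner Q.proj Q.snd (W Q.proj))
      (((contMDiff_fiberInner (g := g) hW) _).mdifferentiableAt (by simp)) hsymm
  rw [mvfderiv_congr hev]
  have hcomp : mvfderiv I.tangent (G ∘ e) Q ξ = mvfderiv (I.prod 𝓘(ℝ, E)) G (e Q)
      (mfderiv I.tangent (I.prod 𝓘(ℝ, E)) e Q ξ) := mvfderiv_comp_apply Q hG heQ ξ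
  have hsplit := mfderiv_prod_eq_add_apply hG
    (v := mfderiv I.tangent (I.prod 𝓘(ℝ, E)) e Q ξ)
  have hmf := mfderiv_trivializationAt p₀ hQ ξ
  have hfst : (mfderiv I.tangent (I.prod 𝓘(ℝ, E)) e Q ξ : E × E).1 = projMap Q ξ :=
    congrArg Prod.fst hmf
  have hsnd : (mfderiv I.tangent (I.prod 𝓘(ℝ, E)) e Q ξ : E × E).2 =
      mvfderiv I.tangent (fun Q' => (e Q').2) Q ξ := congrArg Prod.snd hmf
  have hextd : MDifferentiableAt I I.tangent
      (fun x => (⟨x, e.symm x (e Q).2⟩ : TangentBundle I M)) Q.proj :=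
    MDifferentiableAt.comp Q.proj
      (g := fun z : M × E => (⟨z.1, e.symm z.1 z.2⟩ : TangentBundle I M))
      (f := fun x => (x, (e Q).2)) hsymm (mdifferentiableAt_id.prodMk mdifferentiableAt_const)
  have hA : mvfderiv I (fun x => G (x, (e Q).2)) Q.proj (projMap Q ξ) =
      g.inner Q.proj (cov (fun x => e.symm x (e Q).2) Q.proj (projMap Q ξ)) (W Q.proj) +
        g.inner Q.proj Q.snd (cov W Q.proj (projMap Q ξ)) := by
    have := hcov.metric Q.proj (projMap Q ξ) (fun x => e.symm x (e Q).2) W hextd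
      (mdiffAt_of_contMDiff hW _)
    have h1 : e.symm Q.proj (e Q).2 = Q.snd := e.symm_apply_apply_mk hQ Q.snd
    rw [h1] at this
    exact this
  have hB : mvfderiv 𝓘(ℝ, E) (fun y => G (Q.proj, y)) (e Q).2
      (mvfderiv I.tangent (fun Q' => (e Q').2) Q ξ) =
      g.inner Q.proj (e.symmL ℝ Q.proj (mvfderiv I.tangent (fun Q' => (e Q').2) Q ξ))
        (W Q.proj) := by
    let T₀ : E →ₗ[ℝ] ℝ :=
      { toFun := fun y => g.inner Q.proj (e.symmL ℝ Q.proj y) (W Q.proj)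
        map_add' := fun y z => by rw [map_add, map_add, _root_.add_apply]
        map_smul' := fun c y => by rw [map_smul, map_smul, _root_.smul_apply, RingHom.id_apply] }
    let T : E →L[ℝ] ℝ := T₀.toContinuousLinearMap
    have hT : (fun y => G (Q.proj, y)) = T := by
      funext y
      change _ = g.inner Q.proj (e.symmL ℝ Q.proj y) (W Q.proj)
      rw [e.symmL_apply]
      exact hQ
    rw [hT]
    have := (T.hasMFDerivAt (x := (e Q).2)).mfderiv
    exact congr($this _)
  rw [hcomp]
  have hsplit' : mvfderiv (I.prod 𝓘(ℝ, E)) G (e Q) (mfderiv I.tangent (I.prod 𝓘(ℝ, E)) e Q ξ) =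
      mvfderiv I (fun x => G (x, (e Q).2)) Q.proj (projMap Q ξ) +
      mvfderiv 𝓘(ℝ, E) (fun y => G (Q.proj, y)) (e Q).2
      (mvfderiv I.tangent (fun Q' => (e Q').2) Q ξ) := by
    rw [← hsnd, ← hfst]
    exact hsplit
  rw [hsplit', hA, hB, map_add, _root_.add_apply]
  ring

/-- Positive definiteness, tested on a smooth field through `v - w`. -/
theorem eq_of_forall_inner_eq [T2Space M] {p : M} {v w : TangentSpace I p}
    (h : ∀ W : ∀ x : M, TangentSpace I x, CMDiff ∞ (T% W) →
      g.inner p v (W p) = g.inner p w (W p)) : v = w := by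
  by_contra hne
  obtain ⟨W, hW, hWp⟩ := exists_contMDiff_apply_eq (I := I) (v - w)
  have := g.pos p (v - w) (sub_ne_zero.2 hne)
  have h' := h W hW
  rw [hWp] at h'
  rw [(g.inner p).map_sub, _root_.sub_apply, h', sub_self] at this
  exact lt_irrefl _ this

/-- The derivative of the fibrewise linear function `g(·, W)` on the tangent bundle. -/
theorem mvfderiv_fiberInner
    (hcov : IsLeviCivita cov (fun x v w => g.inner x v w)) (hW : CMDiff ∞ (T% W))
    (Q : TangentBundle I M) (ξ : TangentSpace I.tangent Q) :
    mvfderiv I.tangent (fun Q : TangentBundle I M => g.inner Q.proj Q.snd (W Q.proj)) Q ξ =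
      g.inner Q.proj (connectionMap cov Q ξ) (W Q.proj) +
      g.inner Q.proj Q.snd (cov W Q.proj (projMap Q ξ)) :=
  -- For the trivialization centred at `Q.proj`, the bracketed sum is `connectionMap` by definition:
  -- `FiberBundle.extend` is the field with constant components.
  mvfderiv_fiberInner_trivialization hcov hW Q.proj
    (FiberBundle.mem_baseSet_trivializationAt' _) ξ

/-- The connection map in an arbitrary standard trivialization. -/
theorem connectionMap_eq_trivialization [T2Space M]
    (hcov : IsLeviCivita cov (fun x v w => g.inner x v w)) (p₀ : M)
    {Q : TangentBundle I M}
    (hQ : Q.proj ∈ (trivializationAt E (TangentSpace I : M → Type _) p₀).baseSet)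
    (ξ : TangentSpace I.tangent Q) :
    connectionMap cov Q ξ =
      (trivializationAt E (TangentSpace I : M → Type _) p₀).symmL ℝ Q.proj
          (mvfderiv I.tangent
            (fun Q' => (trivializationAt E (TangentSpace I : M → Type _) p₀ Q').2) Q ξ) +
          cov (fun x => (trivializationAt E (TangentSpace I : M → Type _) p₀).symm x
            (trivializationAt E (TangentSpace I : M → Type _) p₀ Q).2) Q.proj (projMap Q ξ) :=
  eq_of_forall_inner_eq (g := g) fun W hW => by
    -- The derivative of `g(·, W)` does not depend on the trivialization used to compute it, and
    -- neither does its second term; so the first terms agree for every `W`.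
    have h1 := mvfderiv_fiberInner hcov hW Q ξ
    rw [mvfderiv_fiberInner_trivialization hcov hW p₀ hQ ξ] at h1
    exact (add_right_cancel h1).symm

end FiberDerivative

/-! ### Smoothness of lifts -/

section LiftSmooth

variable {E : Type*} [NormedAddCommGroup E] [NormedSpace ℝ E] [FiniteDimensional ℝ E]
  {H : Type*} [TopologicalSpace H] {I : ModelWithCorners ℝ E H}
  {M : Type*} [TopologicalSpace M] [ChartedSpace H M] [IsManifold I ∞ M]
  {g : ContMDiffRiemannianMetric I ∞ E (TangentSpace I : M → Type _)}
  {cov : CovariantDerivative I E (TangentSpace I : M → Type _)}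
  {X Y Z W : ∀ x : M, TangentSpace I x}

/-- A vector field on the tangent bundle is smooth at `P` if its projection to the base and its
fibre component in the standard trivialization are. -/
theorem contMDiffAt_of_projMap_of_fiberCoord {n : ℕ∞ω}
    {A : ∀ Q : TangentBundle I M, TangentSpace I.tangent Q} {P : TangentBundle I M}
    (h1 : ContMDiffAt I.tangent I.tangent n
      (fun Q : TangentBundle I M => (⟨Q.proj, projMap Q (A Q)⟩ : TangentBundle I M)) P)
    (h2 : ContMDiffAt I.tangent 𝓘(ℝ, E) n (fun Q : TangentBundle I M => mvfderiv I.tangent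
      (fun Q' => (trivializationAt E (TangentSpace I : M → Type _) P.proj Q').2) Q (A Q)) P) :
    ContMDiffAt I.tangent I.tangent.tangent n
      (fun Q => (⟨Q, A Q⟩ : TangentBundle I.tangent (TangentBundle I M))) P := by
  set e := trivializationAt E (TangentSpace I : M → Type _) P.proj with he
  refine (contMDiffAt_section (F := E × E)
    (E := (TangentSpace I.tangent : TangentBundle I M → Type _)) _).2 ?_
  have h1' := (contMDiffAt_totalSpace.1 h1).2
  refine (h1'.prodMk_space h2).congr_of_eventuallyEq ?_
  have hP : P ∈ e.source := FiberBundle.mem_trivializationAt_proj_source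
  filter_upwards [e.open_source.mem_nhds hP,
    (chartAt (ModelProd H E) P).open_source.mem_nhds (mem_chart_source _ P)] with Q hQ hQ2
  have hQ' : Q.proj ∈ (chartAt H P.proj).source := e.mem_source.1 hQ
  have k1 := congr($(TangentBundle.continuousLinearMapAt_trivializationAt (I := I.tangent) hQ2)
    (A Q))
  have k2 := congr($(TangentBundle.continuousLinearMapAt_trivializationAt (I := I) hQ')
    (projMap Q (A Q)))
  have d1 : MDifferentiableAt I.tangent 𝓘(ℝ, E)
      (fun Q : TangentBundle I M => extChartAt I P.proj Q.proj) Q :=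
    MDifferentiableAt.comp Q (mdifferentiableAt_extChartAt hQ')
      (mdifferentiableAt_proj (TangentSpace I : M → Type _))
  have d2 : MDifferentiableAt I.tangent 𝓘(ℝ, E) (fun Q : TangentBundle I M => (e Q).2) Q :=
    MDifferentiableAt.comp Q mdifferentiableAt_snd (mdifferentiableAt_trivializationAt P.proj hQ')
  -- The chart of `TM` at `P` pairs the chart of `M` with the fibre coordinate, and the
  -- trivialization of `T(TM)` is its differential. Hence the components of `A` are those of `dπ A`
  -- and the derivative of the fibre coordinate.
  have k3 : (extChartAt I.tangent P : TangentBundle I M → E × E) =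
      fun Q => (extChartAt I P.proj Q.proj, (e Q).2) := by
    rw [FiberBundle.extChartAt]
    rfl
  have k4 : mfderiv I.tangent 𝓘(ℝ, E × E) (extChartAt I.tangent P) Q (A Q) =
      ((mfderiv I 𝓘(ℝ, E) (extChartAt I P.proj) Q.proj (projMap Q (A Q)),
        mvfderiv I.tangent (fun Q' => (e Q').2) Q (A Q)) : E × E) := by
    rw [k3]
    have h := HasMFDerivAt.mfderiv (I' := 𝓘(ℝ, E × E)) ⟨d1.continuousAt.prodMk d2.continuousAt,
      d1.hasMFDerivAt.2.prodMk d2.hasMFDerivAt.2⟩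
    have h5 := mfderiv_comp_apply Q (mdifferentiableAt_extChartAt hQ')
      (mdifferentiableAt_proj (IB := I) (TangentSpace I : M → Type _)) (A Q)
    refine congr($h (A Q)).trans ?_
    exact Prod.ext h5 rfl
  rw [Trivialization.continuousLinearMapAt_apply_of_mem ℝ _ hQ'] at k2
  rw [k4, ← k2, Trivialization.continuousLinearMapAt_apply_of_mem ℝ _ hQ2] at k1
  exact k1

/-- A vector field on the tangent bundle whose images under `dπ` and `K` are smooth vector fields
of the base is smooth. -/
theorem contMDiff_of_projMap_of_connectionMap [T2Space M]
    (hcov : IsLeviCivita cov (fun x v w => g.inner x v w))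
    (hX : CMDiff ∞ (T% X)) (hY : CMDiff ∞ (T% Y))
    {A : ∀ Q : TangentBundle I M, TangentSpace I.tangent Q}
    (hA : ∀ Q, projMap Q (A Q) = X Q.proj) (hA' : ∀ Q, connectionMap cov Q (A Q) = Y Q.proj) :
    ContMDiff I.tangent I.tangent.tangent ∞
      (fun Q => (⟨Q, A Q⟩ : TangentBundle I.tangent (TangentBundle I M))) := by
  intro P
  apply contMDiffAt_of_projMap_of_fiberCoord
  · simp only [hA]
    exact (hX.comp contMDiff_proj) P
  set e := trivializationAt E (TangentSpace I : M → Type _) P.proj with he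
  let b := Module.finBasis ℝ E
  have hPe : P.proj ∈ e.baseSet := FiberBundle.mem_baseSet_trivializationAt' _
  have hmem : ∀ x ∈ e.baseSet, ∀ᶠ x' in 𝓝 x, x' ∈ e.baseSet := fun x hx =>
    e.open_baseSet.mem_nhds hx
  -- The local frame with constant components `b i` is replaced by global smooth fields with the
  -- same germs at `P.proj`, so that smoothness of `∇` on global fields applies.
  have hfr : ∀ i, ∃ S : ∀ x : M, TangentSpace I x, CMDiff ∞ (T% S) ∧
      S =ᶠ[𝓝 P.proj] fun x => e.symmL ℝ x (b i) := by
    intro i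
    obtain ⟨S, hS, hS'⟩ := exists_contMDiff_eventuallyEq_extend (I := I) (e.symm P.proj (b i))
    refine ⟨S, hS, ?_⟩
    filter_upwards [hS', hmem _ hPe] with x hx hxe
    rw [hx, e.symmL_apply hxe]
    change e.symm x (e ⟨P.proj, e.symm P.proj (b i)⟩).2 = _
    rw [congrArg Prod.snd (e.apply_mk_symm hPe (b i))]
  choose S hS hSe using hfr
  have hyd : ∀ y : E, ∀ x ∈ e.baseSet,
      MDiffAt (T% (fun x => e.symmL ℝ x y : ∀ x : M, TangentSpace I x)) x := by
    intro y x hx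
    refine ContMDiffAt.mdifferentiableAt (n := 1) ?_ one_ne_zero
    refine (e.contMDiffAt_section_iff hx).2
      ((contMDiffAt_const (c := y)).congr_of_eventuallyEq ?_)
    filter_upwards [hmem x hx] with x' hx'
    rw [e.symmL_apply hx']
    exact congrArg Prod.snd (e.apply_mk_symm hx' y)
  have hlin : ∀ x ∈ e.baseSet, ∀ y : E, cov (fun x => e.symmL ℝ x y) x =
      ∑ i, b.repr y i • cov (fun x => e.symmL ℝ x (b i)) x := by
    intro x hx y
    let L : E →ₗ[ℝ] (TangentSpace I x →L[ℝ] TangentSpace I x) :=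
      { toFun := fun y => cov (fun x => e.symmL ℝ x y) x
        map_add' := fun y z => by
          rw [← cov.isCovariantDerivativeOn.add (hyd y x hx) (hyd z x hx)]
          congr 1
          funext x
          exact map_add _ y z
        map_smul' := fun c y => by
          rw [RingHom.id_apply, ← cov.isCovariantDerivativeOn.smul_const c (hyd y x hx)]
          congr 1
          funext x
          exact map_smul _ c y }
    change L y = ∑ i, b.repr y i • L (b i)
    conv_lhs => rw [← b.sum_repr y]
    simp only [map_sum, map_smul]
  have hsec : ∀ {Z : ∀ x : M, TangentSpace I x}, CMDiff ∞ (T% Z) →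
      ContMDiffAt I.tangent 𝓘(ℝ, E) ∞
        (fun Q : TangentBundle I M => (e ⟨Q.proj, Z Q.proj⟩).2) P := fun hZ =>
    (contMDiffAt_totalSpace.1 ((hZ.comp contMDiff_proj) P)).2
  have hfib : ContMDiffAt I.tangent 𝓘(ℝ, E) ∞ (fun Q : TangentBundle I M => (e Q).2) P :=
    (contMDiffAt_totalSpace.1 (contMDiff_id (I := I.tangent) P)).2
  -- Solving `K(A) = Y` for the fibre component gives `ẏ = Y - Γ(X, y)`. Since `Γ` is linear in `y`,
  -- it expands into the coordinates of `y` times the smooth fields `∇_X (S i)`.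
  have hs : ContMDiffAt I.tangent 𝓘(ℝ, E) ∞ (fun Q : TangentBundle I M =>
      (e ⟨Q.proj, Y Q.proj⟩).2 -
        ∑ i, b.repr (e Q).2 i • (e ⟨Q.proj, cov (S i) Q.proj (X Q.proj)⟩).2) P := by
    refine (hsec hY).sub (ContMDiffAt.sum fun i _ => ?_)
    have hc : ContMDiffAt I.tangent 𝓘(ℝ) ∞ (fun Q : TangentBundle I M => b.repr (e Q).2 i) P :=
      ((LinearMap.toContinuousLinearMap (b.coord i)).contMDiff _).comp P hfib
    exact hc.smul (hsec (contMDiff_cov hcov.smooth hX (hS i)))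
  refine hs.congr_of_eventuallyEq ?_
  -- Covariant derivatives see germs, so `S i` must agree with the frame near every nearby `x`, not
  -- only at it.
  have hev : ∀ᶠ x in 𝓝 P.proj, x ∈ e.baseSet ∧
      ∀ i, S i =ᶠ[𝓝 x] fun x => e.symmL ℝ x (b i) :=
    (hmem _ hPe).and (eventually_all.2 fun i => eventually_eventually_nhds.2 (hSe i))
  filter_upwards [(contMDiff_proj (I := I) (M := M)).continuous.continuousAt.eventually hev]
    with Q ⟨hQ, hQS⟩
  have h := connectionMap_eq_trivialization hcov P.proj hQ (A Q)
  rw [hA, hA', cov.isCovariantDerivativeOn.congr_of_eventuallyEq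
    (σ' := fun x => e.symmL ℝ x (e Q).2) ?_ (hyd _ _ hQ) univ_mem ?_, hlin _ hQ] at h
  · have h2 := congrArg (fun v => (e ⟨Q.proj, v⟩).2) h
    simp only [← e.continuousLinearMapAt_apply_of_mem ℝ hQ] at h2 ⊢
    rw [map_add, e.continuousLinearMapAt_symmL hQ] at h2
    rw [eq_sub_iff_add_eq, h2]
    congr 1
    rw [_root_.sum_apply, map_sum]
    refine Finset.sum_congr rfl fun i _ => ?_
    rw [_root_.smul_apply, map_smul, cov.isCovariantDerivativeOn.congr_of_eventuallyEq
      (mdiffAt_of_contMDiff (hS i) _) (hyd _ _ hQ) univ_mem (hQS i)]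
  · refine (hyd (e Q).2 _ hQ).congr_of_eventuallyEq ?_
    filter_upwards [hmem _ hQ] with x hx
    rw [e.symmL_apply hx]
  · filter_upwards [hmem _ hQ] with x hx
    rw [e.symmL_apply hx]

end LiftSmooth

/-! ### Symmetries and tensoriality of the curvature -/

section Curvature

variable {E : Type*} [NormedAddCommGroup E] [NormedSpace ℝ E]
  {H : Type*} [TopologicalSpace H] {I : ModelWithCorners ℝ E H}
  {M : Type*} [TopologicalSpace M] [ChartedSpace H M] [IsManifold I ∞ M]
  {g : ContMDiffRiemannianMetric I ∞ E (TangentSpace I : M → Type _)}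
  {cov : CovariantDerivative I E (TangentSpace I : M → Type _)}
  {X Y Z W X' Y' Z' : ∀ x : M, TangentSpace I x}

/-- The function `Xf` is the fibre component of the tangent map of `f` composed with `X`. -/
theorem mdifferentiable_mvfderiv {f : M → ℝ} (hf : ContMDiff I 𝓘(ℝ) ∞ f) (hX : CMDiff ∞ (T% X)) :
    MDifferentiable I 𝓘(ℝ) (fun x => mvfderiv I f x (X x)) := by
  have h1 : ContMDiff I 𝓘(ℝ).tangent 1 (fun x => tangentMap I 𝓘(ℝ) f ⟨x, X x⟩) :=
    (hf.contMDiff_tangentMap (m := 1) (by rw [one_add_one_eq_two]; exact ENat.LEInfty.out)).comp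
      (hX.of_le (ENat.LEInfty.out))
  exact ((contMDiff_snd_tangentBundle_modelSpace ℝ 𝓘(ℝ)).comp h1).mdifferentiable one_ne_zero

theorem contMDiffAt_two_of_contMDiff (h : CMDiff ∞ (T% X)) (x : M) : CMDiffAt 2 (T% X) x :=
  (h x).of_le (ENat.LEInfty.out)

theorem cov_congr (hZ : CMDiff ∞ (T% Z)) {x : M} (h : Z =ᶠ[𝓝 x] Z') : cov Z x = cov Z' x :=
  cov.isCovariantDerivativeOn.congr_of_eventuallyEq (mdiffAt_of_contMDiff hZ x)
    ((mdiffAt_of_contMDiff hZ x).congr_of_eventuallyEq (h.symm.mono fun y hy =>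
      congrArg (fun v => (⟨y, v⟩ : TangentBundle I M)) hy))
    univ_mem h

theorem cov_sub (hY : CMDiff ∞ (T% Y)) (hZ : CMDiff ∞ (T% Z)) (x : M) :
    cov (Y - Z) x = cov Y x - cov Z x := by
  have h := cov.isCovariantDerivativeOn.add (x := x) (mdiffAt_of_contMDiff (hY.sub_section hZ) x)
    (mdiffAt_of_contMDiff hZ x)
  rw [sub_add_cancel] at h
  rw [h, add_sub_cancel_right]

variable [FiniteDimensional ℝ E]

theorem IsLeviCivita.mlieBracket_eq {b : ∀ x : M, TangentSpace I x → TangentSpace I x → ℝ}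
    (hcov : IsLeviCivita cov b) {x : M} (hX : MDiffAt (T% X) x) (hY : MDiffAt (T% Y) x) :
    mlieBracket I X Y x = cov Y x (X x) - cov X x (Y x) := by
  have : CompleteSpace E := FiniteDimensional.complete ℝ E
  exact (cov.torsion_eq_zero_iff.1 hcov.torsion_eq_zero hX hY).symm

/-- Vanishing torsion makes the bracket a difference of covariant derivatives, already known to be
smooth. -/
theorem contMDiff_mlieBracket (hcov : IsLeviCivita cov (fun x v w => g.inner x v w))
    (hX : CMDiff ∞ (T% X)) (hY : CMDiff ∞ (T% Y)) : CMDiff ∞ (T% (mlieBracket I X Y)) := by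
  have h : mlieBracket I X Y = (fun x => cov Y x (X x)) - fun x => cov X x (Y x) :=
    funext fun x => hcov.mlieBracket_eq (mdiffAt_of_contMDiff hX x) (mdiffAt_of_contMDiff hY x)
  rw [h]
  exact (contMDiff_cov hcov.smooth hX hY).sub_section (contMDiff_cov hcov.smooth hY hX)

theorem curvatureField_swap (x : M) : curvatureField cov X Y Z x = -curvatureField cov Y X Z x := by
  rw [curvatureField, curvatureField, mlieBracket_swap_apply, map_neg]
  abel

/-- Apply `XY - YX - [X, Y] = 0` to the function `g(Z, W)` and expand by metric compatibility. The
mixed terms `g(∇Z, ∇W)` cancel. -/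
theorem inner_curvatureField_skew (hcov : IsLeviCivita cov (fun x v w => g.inner x v w))
    (hX : CMDiff ∞ (T% X)) (hY : CMDiff ∞ (T% Y)) (hZ : CMDiff ∞ (T% Z)) (hW : CMDiff ∞ (T% W))
    (x : M) :
    g.inner x (curvatureField cov X Y Z x) (W x) =
      -g.inner x (Z x) (curvatureField cov X Y W x) := by
  have hf := contMDiff_inner (g := g) hZ hW
  have hder : ∀ {A B C : ∀ x : M, TangentSpace I x}, CMDiff ∞ (T% B) → CMDiff ∞ (T% C) → ∀ x,
      mvfderiv I (fun y => g.inner y (B y) (C y)) x (A x) =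
        g.inner x (cov B x (A x)) (C x) + g.inner x (B x) (cov C x (A x)) := fun hB hC x =>
    hcov.metric x _ _ _ (mdiffAt_of_contMDiff hB x) (mdiffAt_of_contMDiff hC x)
  have hd2 : ∀ {A B : ∀ x : M, TangentSpace I x}, CMDiff ∞ (T% A) → CMDiff ∞ (T% B) →
      mvfderiv I (fun y => mvfderiv I (fun y => g.inner y (Z y) (W y)) y (A y)) x (B x) =
      g.inner x (cov (fun y => cov Z y (A y)) x (B x)) (W x) +
        g.inner x (cov Z x (A x)) (cov W x (B x)) +
      (g.inner x (cov Z x (B x)) (cov W x (A x)) +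
        g.inner x (Z x) (cov (fun y => cov W y (A y)) x (B x))) := by
    intro A B hA hB
    have hAZ := contMDiff_cov hcov.smooth hA hZ
    have hAW := contMDiff_cov hcov.smooth hA hW
    rw [funext (hder hZ hW (A := A)), mvfderiv_fun_add
      ((contMDiff_inner (g := g) hAZ hW x).mdifferentiableAt (by simp))
      ((contMDiff_inner (g := g) hZ hAW x).mdifferentiableAt (by simp)), _root_.add_apply,
      hder hAZ hW, hder hZ hAW]
  have hbr : mvfderiv I (fun y => g.inner y (Z y) (W y)) x (mlieBracket I X Y x) =
      g.inner x (cov Z x (mlieBracket I X Y x)) (W x) +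
        g.inner x (Z x) (cov W x (mlieBracket I X Y x)) :=
    hder hZ hW (A := mlieBracket I X Y) x
  have h := mvfderiv_mlieBracket (contMDiffAt_two_of_contMDiff hX x)
    (contMDiffAt_two_of_contMDiff hY x)
    ((hf x).of_le (ENat.LEInfty.out))
    (mdifferentiable_mvfderiv hf hX x) (mdifferentiable_mvfderiv hf hY x)
  rw [hbr, hd2 hX hY, hd2 hY hX] at h
  simp only [curvatureField, map_sub, _root_.sub_apply]
  linarith

theorem curvatureField_bianchi (hcov : IsLeviCivita cov (fun x v w => g.inner x v w))
    (hX : CMDiff ∞ (T% X)) (hY : CMDiff ∞ (T% Y)) (hZ : CMDiff ∞ (T% Z)) (x : M) :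
    curvatureField cov X Y Z x + curvatureField cov Y Z X x + curvatureField cov Z X Y x = 0 := by
  have : CompleteSpace E := FiniteDimensional.complete ℝ E
  have : IsManifold I (minSmoothness ℝ 3) M := by
    rw [minSmoothness_of_isRCLikeNormedField]; infer_instance
  have hms : minSmoothness ℝ 2 = 2 := minSmoothness_of_isRCLikeNormedField
  -- Vanishing torsion, used twice: `∇_A(∇_B C - ∇_C B) = ∇_A[B, C] = [A, [B, C]] + ∇_{[B, C]}A`. In
  -- the cyclic sum the last terms cancel the bracket terms of the curvature, and the double
  -- brackets vanish by Jacobi.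
  have nested : ∀ {A B C : ∀ x : M, TangentSpace I x}, CMDiff ∞ (T% A) → CMDiff ∞ (T% B) →
      CMDiff ∞ (T% C) →
      cov (fun y => cov C y (B y)) x (A x) - cov (fun y => cov B y (C y)) x (A x) =
        mlieBracket I A (mlieBracket I B C) x + cov A x (mlieBracket I B C x) := by
    intro A B C hA hB hC
    have hBC := contMDiff_mlieBracket hcov hB hC
    have h : mlieBracket I B C = (fun x => cov C x (B x)) - fun x => cov B x (C x) :=
      funext fun x => hcov.mlieBracket_eq (mdiffAt_of_contMDiff hB x) (mdiffAt_of_contMDiff hC x)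
    rw [hcov.mlieBracket_eq (mdiffAt_of_contMDiff hA x) (mdiffAt_of_contMDiff hBC x),
      sub_add_cancel, h, cov_sub (contMDiff_cov hcov.smooth hB hC)
        (contMDiff_cov hcov.smooth hC hB), _root_.sub_apply]
  have J := leibniz_identity_mlieBracket_apply (I := I) (x := x)
    (hms ▸ contMDiffAt_two_of_contMDiff hX x) (hms ▸ contMDiffAt_two_of_contMDiff hY x)
    (hms ▸ contMDiffAt_two_of_contMDiff hZ x)
  have s1 : mlieBracket I (mlieBracket I X Y) Z x = - mlieBracket I Z (mlieBracket I X Y) x :=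
    mlieBracket_swap_apply
  have s2 : mlieBracket I Y (mlieBracket I X Z) x = - mlieBracket I Y (mlieBracket I Z X) x := by
    have h0 : MDiffAt (T% (mlieBracket I Z X)) x :=
      mdiffAt_of_contMDiff (contMDiff_mlieBracket hcov hZ hX) x
    have h1 : mlieBracket I X Z = (-1 : ℝ) • mlieBracket I Z X := by
      rw [mlieBracket_swap, neg_one_smul]
    rw [h1, mlieBracket_const_smul_right h0, neg_one_smul]
  rw [s1, s2] at J
  simp only [curvatureField]
  linear_combination (norm := module)
    nested hX hY hZ + nested hY hZ hX + nested hZ hX hY + J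

/-- Algebraic curvature tensors are symmetric under exchange of the two pairs of arguments. -/
theorem pair_symm_of_bianchi {V : Type*} {T : V → V → V → V → ℝ}
    (h1 : ∀ a b c d, T a b c d = -T b a c d) (h2 : ∀ a b c d, T a b c d = -T a b d c)
    (h3 : ∀ a b c d, T a b c d + T b c a d + T c a b d = 0) (a b c d : V) :
    T a b c d = T c d a b := by
  -- The octahedron argument: the Bianchi identities for the four cyclic rotations of `a, b, c, d`
  -- share their terms up to the two skew symmetries.
  linarith [h3 a b c d, h3 b c d a, h3 c d a b, h3 d a b c, h1 a b c d, h1 c a b d, h2 c a b d,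
    h2 b c a d, h2 a b c d, h1 c d b a, h2 c d a b, h1 d b c a, h2 d b c a, h1 d a c b, h2 d a c b,
    h2 a c d b, h1 a c d b, h2 b d a c, h1 b d a c, h2 d a b c, h1 d a b c]

/-- The algebraic lemma is applied with smooth fields, not tangent vectors, as arguments:
tensoriality is not yet available and will be deduced from this symmetry. -/
theorem inner_curvatureField_pair_symm (hcov : IsLeviCivita cov (fun x v w => g.inner x v w))
    (hX : CMDiff ∞ (T% X)) (hY : CMDiff ∞ (T% Y)) (hZ : CMDiff ∞ (T% Z)) (hW : CMDiff ∞ (T% W))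
    (x : M) :
    g.inner x (curvatureField cov X Y Z x) (W x) = g.inner x (curvatureField cov Z W X x) (Y x) :=
  pair_symm_of_bianchi (V := {A : ∀ x : M, TangentSpace I x // CMDiff ∞ (T% A)})
    (T := fun A B C D => g.inner x (curvatureField cov A.1 B.1 C.1 x) (D.1 x))
    (fun A B C D => by simp only [curvatureField_swap (X := A.1), map_neg, _root_.neg_apply])
    (fun A B C D => by
      simp only [inner_curvatureField_skew hcov A.2 B.2 C.2 D.2 x, g.symm x (C.1 x)])
    (fun A B C D => by
      rw [← _root_.add_apply, ← _root_.add_apply, ← map_add, ← map_add,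
        curvatureField_bianchi hcov A.2 B.2 C.2, map_zero, _root_.zero_apply])
    ⟨X, hX⟩ ⟨Y, hY⟩ ⟨Z, hZ⟩ ⟨W, hW⟩

/-- Locality: covariant derivatives and brackets depend only on germs. -/
theorem curvatureField_congr (hcov : IsLeviCivita cov (fun x v w => g.inner x v w))
    (hX : CMDiff ∞ (T% X)) (hY : CMDiff ∞ (T% Y)) (hZ : CMDiff ∞ (T% Z)) {x : M}
    (hXX' : X =ᶠ[𝓝 x] X') (hYY' : Y =ᶠ[𝓝 x] Y') (hZZ' : Z =ᶠ[𝓝 x] Z') :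
    curvatureField cov X Y Z x = curvatureField cov X' Y' Z' x := by
  have h : ∀ {A A' : ∀ x : M, TangentSpace I x}, CMDiff ∞ (T% A) → A =ᶠ[𝓝 x] A' →
      cov (fun y => cov Z y (A y)) x = cov (fun y => cov Z' y (A' y)) x := by
    intro A A' hA hAA'
    refine cov_congr (contMDiff_cov hcov.smooth hA hZ) ?_
    filter_upwards [hAA', eventually_eventually_nhds.2 hZZ'] with y h1 h2
    rw [h1, cov_congr hZ h2]
  rw [curvatureField, curvatureField, h hX hXX', h hY hYY', cov_congr hZ hZZ',
    hXX'.mlieBracket_vectorField_eq hYY', hXX'.eq_of_nhds, hYY'.eq_of_nhds]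

variable [T2Space M]

/-- The symmetries carry each argument in turn outside the curvature, into a slot of `g`, where only
its value at `x` matters. Skew symmetry does this for `Z`, pair symmetry for `Y`, and both together
for `X`. -/
theorem curvatureField_eq_of_apply_eq (hcov : IsLeviCivita cov (fun x v w => g.inner x v w))
    (hX : CMDiff ∞ (T% X)) (hY : CMDiff ∞ (T% Y)) (hZ : CMDiff ∞ (T% Z))
    (hX' : CMDiff ∞ (T% X')) (hY' : CMDiff ∞ (T% Y')) (hZ' : CMDiff ∞ (T% Z')) {x : M}
    (hXX' : X x = X' x) (hYY' : Y x = Y' x) (hZZ' : Z x = Z' x) :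
    curvatureField cov X Y Z x = curvatureField cov X' Y' Z' x := by
  refine eq_of_forall_inner_eq (g := g) fun W hW => ?_
  rw [inner_curvatureField_skew hcov hX hY hZ hW, hZZ',
    ← inner_curvatureField_skew hcov hX hY hZ' hW, inner_curvatureField_pair_symm hcov hX hY hZ' hW,
    hYY', inner_curvatureField_skew hcov hZ' hW hX hY', hXX',
    ← inner_curvatureField_skew hcov hZ' hW hX' hY',
    inner_curvatureField_pair_symm hcov hZ' hW hX' hY']

/-- The curvature tensor evaluated on smooth vector fields. -/
theorem curvature_apply (hcov : IsLeviCivita cov (fun x v w => g.inner x v w))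
    (hX : CMDiff ∞ (T% X)) (hY : CMDiff ∞ (T% Y)) (hZ : CMDiff ∞ (T% Z)) (x : M) :
    curvature cov x (X x) (Y x) (Z x) = curvatureField cov X Y Z x := by
  -- The extensions defining `curvature` are smooth only locally: locality passes to global fields
  -- with the same germs, then tensoriality to `X, Y, Z`.
  obtain ⟨X', hX', hXe⟩ := exists_contMDiff_eventuallyEq_extend (I := I) (X x)
  obtain ⟨Y', hY', hYe⟩ := exists_contMDiff_eventuallyEq_extend (I := I) (Y x)
  obtain ⟨Z', hZ', hZe⟩ := exists_contMDiff_eventuallyEq_extend (I := I) (Z x)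
  rw [curvature, ← curvatureField_congr hcov hX' hY' hZ' hXe hYe hZe]
  exact curvatureField_eq_of_apply_eq hcov hX' hY' hZ' hX hY hZ
    (hXe.eq_of_nhds.trans (FiberBundle.extend_apply_self ..))
    (hYe.eq_of_nhds.trans (FiberBundle.extend_apply_self ..))
    (hZe.eq_of_nhds.trans (FiberBundle.extend_apply_self ..))

end Curvature

/-! ### The Koszul formula -/

section Koszul

variable {E : Type*} [NormedAddCommGroup E] [NormedSpace ℝ E] [FiniteDimensional ℝ E]
  {H : Type*} [TopologicalSpace H] {I : ModelWithCorners ℝ E H}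
  {M : Type*} [TopologicalSpace M] [ChartedSpace H M] [IsManifold I ∞ M]

/-- The Koszul formula. -/
theorem IsLeviCivita.koszul {cov : CovariantDerivative I E (TangentSpace I : M → Type _)}
    {b : ∀ x : M, TangentSpace I x → TangentSpace I x → ℝ} (hcov : IsLeviCivita cov b)
    (hsymm : ∀ x v w, b x v w = b x w v) (hsub : ∀ x v v' w, b x (v - v') w = b x v w - b x v' w)
    {A B C : ∀ x : M, TangentSpace I x} {x : M}
    (hA : MDiffAt (T% A) x) (hB : MDiffAt (T% B) x) (hC : MDiffAt (T% C) x) :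
    2 * b x (cov B x (A x)) (C x) =
      mvfderiv I (fun y => b y (B y) (C y)) x (A x) +
        mvfderiv I (fun y => b y (C y) (A y)) x (B x) -
        mvfderiv I (fun y => b y (A y) (B y)) x (C x) +
        b x (mlieBracket I A B x) (C x) - b x (mlieBracket I B C x) (A x) +
        b x (mlieBracket I C A x) (B x) := by
  rw [hcov.metric x _ _ _ hB hC, hcov.metric x _ _ _ hC hA, hcov.metric x _ _ _ hA hB,
    hcov.mlieBracket_eq hA hB, hcov.mlieBracket_eq hB hC, hcov.mlieBracket_eq hC hA,
    hsub, hsub, hsub, hsymm x (B x), hsymm x (C x), hsymm x (A x)]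
  ring

end Koszul

/-! ### Curvature identities on tangent vectors -/

section CurvatureTensor

variable {E : Type*} [NormedAddCommGroup E] [NormedSpace ℝ E] [FiniteDimensional ℝ E]
  {H : Type*} [TopologicalSpace H] {I : ModelWithCorners ℝ E H}
  {M : Type*} [TopologicalSpace M] [ChartedSpace H M] [T2Space M] [IsManifold I ∞ M]
  {g : ContMDiffRiemannianMetric I ∞ E (TangentSpace I : M → Type _)}
  {cov : CovariantDerivative I E (TangentSpace I : M → Type _)} {p : M}

theorem curvature_swap (hcov : IsLeviCivita cov (fun x v w => g.inner x v w))
    (a b c : TangentSpace I p) : curvature cov p a b c = -curvature cov p b a c := by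
  obtain ⟨X, hX, rfl⟩ := exists_contMDiff_apply_eq (I := I) a
  obtain ⟨Y, hY, rfl⟩ := exists_contMDiff_apply_eq (I := I) b
  obtain ⟨Z, hZ, rfl⟩ := exists_contMDiff_apply_eq (I := I) c
  rw [curvature_apply hcov hX hY hZ, curvature_apply hcov hY hX hZ, curvatureField_swap]

theorem inner_curvature_skew (hcov : IsLeviCivita cov (fun x v w => g.inner x v w))
    (a b c d : TangentSpace I p) :
    g.inner p (curvature cov p a b c) d = -g.inner p (curvature cov p a b d) c := by
  obtain ⟨X, hX, rfl⟩ := exists_contMDiff_apply_eq (I := I) a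
  obtain ⟨Y, hY, rfl⟩ := exists_contMDiff_apply_eq (I := I) b
  obtain ⟨Z, hZ, rfl⟩ := exists_contMDiff_apply_eq (I := I) c
  obtain ⟨W, hW, rfl⟩ := exists_contMDiff_apply_eq (I := I) d
  rw [curvature_apply hcov hX hY hZ, curvature_apply hcov hX hY hW,
    inner_curvatureField_skew hcov hX hY hZ hW, g.symm]

theorem curvature_bianchi (hcov : IsLeviCivita cov (fun x v w => g.inner x v w))
    (a b c : TangentSpace I p) :
    curvature cov p a b c + curvature cov p b c a + curvature cov p c a b = 0 := by
  obtain ⟨X, hX, rfl⟩ := exists_contMDiff_apply_eq (I := I) a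
  obtain ⟨Y, hY, rfl⟩ := exists_contMDiff_apply_eq (I := I) b
  obtain ⟨Z, hZ, rfl⟩ := exists_contMDiff_apply_eq (I := I) c
  rw [curvature_apply hcov hX hY hZ, curvature_apply hcov hY hZ hX, curvature_apply hcov hZ hX hY,
    curvatureField_bianchi hcov hX hY hZ]

theorem inner_curvature_pair_symm (hcov : IsLeviCivita cov (fun x v w => g.inner x v w))
    (a b c d : TangentSpace I p) :
    g.inner p (curvature cov p a b c) d = g.inner p (curvature cov p c d a) b := by
  obtain ⟨X, hX, rfl⟩ := exists_contMDiff_apply_eq (I := I) a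
  obtain ⟨Y, hY, rfl⟩ := exists_contMDiff_apply_eq (I := I) b
  obtain ⟨Z, hZ, rfl⟩ := exists_contMDiff_apply_eq (I := I) c
  obtain ⟨W, hW, rfl⟩ := exists_contMDiff_apply_eq (I := I) d
  rw [curvature_apply hcov hX hY hZ, curvature_apply hcov hZ hW hX,
    inner_curvatureField_pair_symm hcov hX hY hZ hW]

/-- Pair and skew symmetry move the zero vector into a slot of `g`. Vanishing at zero arguments is
the only part of multilinearity that purely horizontal or vertical lifts require. -/
theorem curvature_zero_left (hcov : IsLeviCivita cov (fun x v w => g.inner x v w))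
    (b c : TangentSpace I p) : curvature cov p 0 b c = 0 :=
  eq_of_forall_inner_eq (g := g) fun W _ => by
    rw [inner_curvature_pair_symm hcov, inner_curvature_skew hcov]
    simp

theorem curvature_zero_right (hcov : IsLeviCivita cov (fun x v w => g.inner x v w))
    (a c : TangentSpace I p) : curvature cov p a 0 c = 0 := by
  rw [curvature_swap hcov, curvature_zero_left hcov, neg_zero]

theorem curvature_apply_zero (hcov : IsLeviCivita cov (fun x v w => g.inner x v w))
    (a b : TangentSpace I p) : curvature cov p a b 0 = 0 :=
  eq_of_forall_inner_eq (g := g) fun W _ => by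
    rw [inner_curvature_skew hcov]
    simp

end CurvatureTensor

/-! ### Brackets of lifts and derivatives of the lifted metric -/

section Lift

variable {E : Type*} [NormedAddCommGroup E] [NormedSpace ℝ E]
  {H : Type*} [TopologicalSpace H] {I : ModelWithCorners ℝ E H}
  {M : Type*} [TopologicalSpace M] [ChartedSpace H M] [IsManifold I ∞ M]
  {g : ContMDiffRiemannianMetric I ∞ E (TangentSpace I : M → Type _)}
  {cov : CovariantDerivative I E (TangentSpace I : M → Type _)}

/-- The vector field `A` on the tangent bundle is the sum of the horizontal lift of `X` and the
vertical lift of `Y`. -/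
structure IsLift (cov : CovariantDerivative I E (TangentSpace I : M → Type _))
    (A : ∀ Q : TangentBundle I M, TangentSpace I.tangent Q) (X Y : ∀ x : M, TangentSpace I x) :
    Prop where
  projMap : ∀ Q, projMap Q (A Q) = X Q.proj
  connectionMap : ∀ Q, connectionMap cov Q (A Q) = Y Q.proj

theorem isLift_hLift (X : ∀ x : M, TangentSpace I x) : IsLift cov (hLift cov X) X 0 :=
  ⟨projMap_hLift cov X, connectionMap_hLift cov X⟩

theorem isLift_vLift (X : ∀ x : M, TangentSpace I x) : IsLift cov (vLift cov X) 0 X :=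
  ⟨projMap_vLift cov X, connectionMap_vLift cov X⟩

variable [FiniteDimensional ℝ E] [T2Space M]

/-- Tangent vectors are determined by their action on smooth functions. -/
theorem eq_of_forall_mvfderiv_eq {p : M} {v w : TangentSpace I p}
    (h : ∀ f : M → ℝ, ContMDiff I 𝓘(ℝ) ∞ f → mvfderiv I f p v = mvfderiv I f p w) : v = w := by
  obtain ⟨f⟩ : Nonempty (SmoothBumpFunction I p) := inferInstance
  -- The test functions are the coordinates of the chart at `p`, cut off by a bump function; they
  -- suffice because the differential of the chart is injective.
  have hF : ContMDiff I 𝓘(ℝ, E) ∞ (fun x => f x • extChartAt I p x) :=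
    f.contMDiff_smul contMDiffOn_extChartAt
  have hev : (fun x => f x • extChartAt I p x) =ᶠ[𝓝 p] extChartAt I p := by
    filter_upwards [f.eventuallyEq_one] with y hy
    rw [hy, Pi.one_apply, one_smul]
  have hd : ∀ v, mvfderiv I (fun x => f x • extChartAt I p x) p v =
      mfderiv I 𝓘(ℝ, E) (extChartAt I p) p v := fun v => mvfderiv_congr hev v
  have hinj : Function.Injective (mfderiv I 𝓘(ℝ, E) (extChartAt I p) p) :=
    (isInvertible_mfderiv_extChartAt (mem_extChartAt_source (I := I) p)).injective
  refine hinj ?_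
  rw [← hd, ← hd]
  refine (Module.finBasis ℝ E).ext_elem fun i => ?_
  let α : E →L[ℝ] ℝ := LinearMap.toContinuousLinearMap ((Module.finBasis ℝ E).coord i)
  have hα : ∀ v : TangentSpace I p, mvfderiv I (fun x => α (f x • extChartAt I p x)) p v =
      α (mvfderiv I (fun x => f x • extChartAt I p x) p v) := fun v => by
    have h1 := mfderiv_comp_apply p (I' := 𝓘(ℝ, E)) (I'' := 𝓘(ℝ)) (g := α)
      (α.mdifferentiableAt) ((hF p).mdifferentiableAt (by simp)) v
    rw [ContinuousLinearMap.mfderiv_eq] at h1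
    exact h1
  have := h _ ((α.contMDiff).comp hF)
  exact (hα v).symm.trans (this.trans (hα w))

variable {A B C : ∀ Q : TangentBundle I M, TangentSpace I.tangent Q}
  {X₁ Y₁ X₂ Y₂ X₃ Y₃ : ∀ x : M, TangentSpace I x}

theorem IsLift.contMDiff (hA : IsLift cov A X₁ Y₁)
    (hcov : IsLeviCivita cov (fun x v w => g.inner x v w))
    (hX₁ : CMDiff ∞ (T% X₁)) (hY₁ : CMDiff ∞ (T% Y₁)) :
    ContMDiff I.tangent I.tangent.tangent ∞
      (fun Q => (⟨Q, A Q⟩ : TangentBundle I.tangent (TangentBundle I M))) :=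
  contMDiff_of_projMap_of_connectionMap hcov hX₁ hY₁ hA.projMap hA.connectionMap

/-- Test on pull-backs: `A(f ∘ π) = (X₁f) ∘ π`, so the commutator of `A` and `B` acts on `f ∘ π` as
that of `X₁` and `X₂` acts on `f`. -/
theorem IsLift.projMap_mlieBracket (hA : IsLift cov A X₁ Y₁) (hB : IsLift cov B X₂ Y₂)
    (hcov : IsLeviCivita cov (fun x v w => g.inner x v w))
    (hX₁ : CMDiff ∞ (T% X₁)) (hY₁ : CMDiff ∞ (T% Y₁))
    (hX₂ : CMDiff ∞ (T% X₂)) (hY₂ : CMDiff ∞ (T% Y₂)) (P : TangentBundle I M) :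
    TangentLift.projMap P (mlieBracket I.tangent A B P) = mlieBracket I X₁ X₂ P.proj := by
  refine eq_of_forall_mvfderiv_eq fun f hf => ?_
  have hfd : MDifferentiable I 𝓘(ℝ) f := hf.mdifferentiable (by simp)
  have hA' := hA.contMDiff hcov hX₁ hY₁
  have hB' := hB.contMDiff hcov hX₂ hY₂
  have hfT : ContMDiff I.tangent 𝓘(ℝ) ∞ (fun Q : TangentBundle I M => f Q.proj) :=
    hf.comp contMDiff_proj
  have h := mvfderiv_mlieBracket (contMDiffAt_two_of_contMDiff hA' P)
    (contMDiffAt_two_of_contMDiff hB' P) ((hfT P).of_le ENat.LEInfty.out)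
    (mdifferentiable_mvfderiv hfT hA' P) (mdifferentiable_mvfderiv hfT hB' P)
  simp only [mvfderiv_comp_proj (hfd _), hA.projMap, hB.projMap] at h
  rw [mvfderiv_comp_proj (f := fun x => mvfderiv I f x (X₁ x)) (mdifferentiable_mvfderiv hf hX₁ _),
    mvfderiv_comp_proj (f := fun x => mvfderiv I f x (X₂ x)) (mdifferentiable_mvfderiv hf hX₂ _),
    hA.projMap, hB.projMap] at h
  rw [h, mvfderiv_mlieBracket (contMDiffAt_two_of_contMDiff hX₁ _)
    (contMDiffAt_two_of_contMDiff hX₂ _) ((hf _).of_le ENat.LEInfty.out)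
    (mdifferentiable_mvfderiv hf hX₁ _) (mdifferentiable_mvfderiv hf hX₂ _)]

theorem IsLeviCivita.mvfderiv_inner (hcov : IsLeviCivita cov (fun x v w => g.inner x v w))
    {Y Z : ∀ x : M, TangentSpace I x} (hY : CMDiff ∞ (T% Y)) (hZ : CMDiff ∞ (T% Z)) (x : M)
    (v : TangentSpace I x) :
    mvfderiv I (fun y => g.inner y (Y y) (Z y)) x v =
      g.inner x (cov Y x v) (Z x) + g.inner x (cov Z x v) (Y x) := by
  rw [hcov.metric x v Y Z (mdiffAt_of_contMDiff hY x) (mdiffAt_of_contMDiff hZ x),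
    g.symm x (Y x)]

/-- Test on `F_W = g(·, W)`, using `A F_W = g(Y₁, W) ∘ π + F_{∇_{X₁} W}` twice. In the commutator
the terms `g(Yᵢ, ∇W)` cancel. After subtracting `g(u, ∇_{[X₁, X₂]} W)` there remains `g(u, R(X₁,
X₂)W) = -g(R(X₁, X₂)u, W)`. -/
theorem IsLift.connectionMap_mlieBracket (hA : IsLift cov A X₁ Y₁) (hB : IsLift cov B X₂ Y₂)
    (hcov : IsLeviCivita cov (fun x v w => g.inner x v w))
    (hX₁ : CMDiff ∞ (T% X₁)) (hY₁ : CMDiff ∞ (T% Y₁))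
    (hX₂ : CMDiff ∞ (T% X₂)) (hY₂ : CMDiff ∞ (T% Y₂)) (P : TangentBundle I M) :
    TangentLift.connectionMap cov P (mlieBracket I.tangent A B P) =
      cov Y₂ P.proj (X₁ P.proj) - cov Y₁ P.proj (X₂ P.proj) -
        curvature cov P.proj (X₁ P.proj) (X₂ P.proj) P.snd := by
  refine eq_of_forall_inner_eq (g := g) fun W hW => ?_
  -- Skew symmetry is stated for fields, so `u` is extended to a smooth field `U`.
  obtain ⟨U, hU, hUP⟩ := exists_contMDiff_apply_eq (I := I) P.snd
  have hA' := hA.contMDiff hcov hX₁ hY₁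
  have hB' := hB.contMDiff hcov hX₂ hY₂
  have hF := contMDiff_fiberInner (g := g) hW
  have hfirst : ∀ {A : ∀ Q : TangentBundle I M, TangentSpace I.tangent Q}
      {X Y : ∀ x : M, TangentSpace I x}, IsLift cov A X Y → ∀ Q : TangentBundle I M,
      mvfderiv I.tangent (fun Q : TangentBundle I M => g.inner Q.proj Q.snd (W Q.proj)) Q (A Q) =
        g.inner Q.proj (Y Q.proj) (W Q.proj) +
          g.inner Q.proj Q.snd (cov W Q.proj (X Q.proj)) := by
    intro A X Y hA Q
    rw [mvfderiv_fiberInner hcov hW, hA.projMap, hA.connectionMap]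
  have hsecond : ∀ {A B : ∀ Q : TangentBundle I M, TangentSpace I.tangent Q}
      {X Y X' Y' : ∀ x : M, TangentSpace I x}, IsLift cov A X Y → IsLift cov B X' Y' →
      CMDiff ∞ (T% X) → CMDiff ∞ (T% Y) →
      mvfderiv I.tangent (fun Q => mvfderiv I.tangent
        (fun Q : TangentBundle I M => g.inner Q.proj Q.snd (W Q.proj)) Q (A Q)) P (B P) =
        g.inner P.proj (cov Y P.proj (X' P.proj)) (W P.proj) +
          g.inner P.proj (cov W P.proj (X' P.proj)) (Y P.proj) +
        (g.inner P.proj (cov W P.proj (X P.proj)) (Y' P.proj) +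
          g.inner P.proj P.snd (cov (fun y => cov W y (X y)) P.proj (X' P.proj))) := by
    intro A B X Y X' Y' hA hB hX hY
    have hXW := contMDiff_cov hcov.smooth hX hW
    have hYW := contMDiff_inner (g := g) hY hW
    have hd : MDiffAt (fun Q : TangentBundle I M => g.inner Q.proj (Y Q.proj) (W Q.proj)) P :=
      ((hYW.comp contMDiff_proj) P).mdifferentiableAt (by simp)
    rw [funext (hfirst hA), mvfderiv_fun_add hd
      ((contMDiff_fiberInner (g := g) hXW P).mdifferentiableAt (by simp)), _root_.add_apply,
      mvfderiv_fiberInner hcov hXW, hB.projMap, hB.connectionMap,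
      mvfderiv_comp_proj (f := fun x => g.inner x (Y x) (W x))
        ((hYW _).mdifferentiableAt (by simp)), hB.projMap, hcov.mvfderiv_inner hY hW,
      g.symm _ (Y' P.proj)]
  have h := mvfderiv_mlieBracket (contMDiffAt_two_of_contMDiff hA' P)
    (contMDiffAt_two_of_contMDiff hB' P) ((hF P).of_le ENat.LEInfty.out)
    (mdifferentiable_mvfderiv hF hA' P) (mdifferentiable_mvfderiv hF hB' P)
  rw [hsecond hA hB hX₁ hY₁, hsecond hB hA hX₂ hY₂, mvfderiv_fiberInner hcov hW,
    hA.projMap_mlieBracket hB hcov hX₁ hY₁ hX₂ hY₂] at h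
  have hcurv := inner_curvatureField_skew hcov hX₁ hX₂ hU hW P.proj
  rw [← curvature_apply hcov hX₁ hX₂ hU, hUP] at hcurv
  simp only [curvatureField, map_sub] at hcurv
  simp only [map_sub, _root_.sub_apply]
  linarith

variable {nablaBar : CovariantDerivative I.tangent (E × E)
    (TangentSpace I.tangent : TangentBundle I M → Type _)} {m₁ m₂ m₃ : ℝ}

/-- On lifts the metric is constant along the fibres, so only the horizontal part `X₁` of `A`
differentiates it. -/
theorem IsLift.mvfderiv_liftMetric (hA : IsLift cov A X₁ Y₁) (hB : IsLift cov B X₂ Y₂)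
    (hC : IsLift cov C X₃ Y₃)
    (hcov : IsLeviCivita cov (fun x v w => g.inner x v w))
    (hX₂ : CMDiff ∞ (T% X₂)) (hY₂ : CMDiff ∞ (T% Y₂))
    (hX₃ : CMDiff ∞ (T% X₃)) (hY₃ : CMDiff ∞ (T% Y₃)) (P : TangentBundle I M) :
    mvfderiv I.tangent (fun Q => liftMetric g cov m₁ m₂ m₃ Q (B Q) (C Q)) P (A P) =
      m₁ * (g.inner P.proj (cov X₂ P.proj (X₁ P.proj)) (X₃ P.proj) +
        g.inner P.proj (cov X₃ P.proj (X₁ P.proj)) (X₂ P.proj)) +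
      m₂ * (g.inner P.proj (cov X₂ P.proj (X₁ P.proj)) (Y₃ P.proj) +
        g.inner P.proj (cov Y₃ P.proj (X₁ P.proj)) (X₂ P.proj) +
        (g.inner P.proj (cov Y₂ P.proj (X₁ P.proj)) (X₃ P.proj) +
        g.inner P.proj (cov X₃ P.proj (X₁ P.proj)) (Y₂ P.proj))) +
      m₃ * (g.inner P.proj (cov Y₂ P.proj (X₁ P.proj)) (Y₃ P.proj) +
        g.inner P.proj (cov Y₃ P.proj (X₁ P.proj)) (Y₂ P.proj)) := by
  have d : ∀ {Y Z : ∀ x : M, TangentSpace I x}, CMDiff ∞ (T% Y) → CMDiff ∞ (T% Z) →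
      MDiffAt (fun x => g.inner x (Y x) (Z x)) P.proj := fun hY hZ =>
    (contMDiff_inner (g := g) hY hZ _).mdifferentiableAt (by simp)
  have c : ∀ (m : ℝ) {f : M → ℝ}, MDiffAt f P.proj → MDiffAt (fun x => m * f x) P.proj :=
    fun m f hf => mdifferentiableAt_const.mul hf
  have hc : ∀ (m : ℝ) {f : M → ℝ}, MDiffAt f P.proj → ∀ v,
      mvfderiv I (fun x => m * f x) P.proj v = m * mvfderiv I f P.proj v := fun m f hf v => by
    rw [mvfderiv_fun_mul mdifferentiableAt_const hf, mvfderiv_const]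
    simp
  have h1 := d hX₂ hX₃
  have h2 := d hX₂ hY₃
  have h3 := d hY₂ hX₃
  have h4 := d hY₂ hY₃
  have hfun : (fun Q => liftMetric g cov m₁ m₂ m₃ Q (B Q) (C Q)) = fun Q : TangentBundle I M =>
      (fun x => m₁ * g.inner x (X₂ x) (X₃ x) +
        m₂ * (g.inner x (X₂ x) (Y₃ x) + g.inner x (Y₂ x) (X₃ x)) +
        m₃ * g.inner x (Y₂ x) (Y₃ x)) Q.proj := by
    funext Q
    simp only [liftMetric, hB.projMap, hC.projMap, hB.connectionMap, hC.connectionMap]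
  have h23 : MDiffAt (fun x => g.inner x (X₂ x) (Y₃ x) + g.inner x (Y₂ x) (X₃ x)) P.proj :=
    h2.add h3
  have h123 : MDiffAt (fun x => m₁ * g.inner x (X₂ x) (X₃ x) +
      m₂ * (g.inner x (X₂ x) (Y₃ x) + g.inner x (Y₂ x) (X₃ x))) P.proj := (c _ h1).add (c _ h23)
  have hall : MDiffAt (fun x => m₁ * g.inner x (X₂ x) (X₃ x) +
      m₂ * (g.inner x (X₂ x) (Y₃ x) + g.inner x (Y₂ x) (X₃ x)) +
      m₃ * g.inner x (Y₂ x) (Y₃ x)) P.proj := h123.add (c _ h4)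
  rw [hfun, mvfderiv_comp_proj hall, hA.projMap, mvfderiv_fun_add h123 (c _ h4),
    _root_.add_apply, mvfderiv_fun_add (c _ h1) (c _ h23), _root_.add_apply, hc _ h1, hc _ h23,
    hc _ h4, mvfderiv_fun_add h2 h3, _root_.add_apply, hcov.mvfderiv_inner hX₂ hX₃,
    hcov.mvfderiv_inner hX₂ hY₃, hcov.mvfderiv_inner hY₂ hX₃, hcov.mvfderiv_inner hY₂ hY₃]

theorem IsLift.liftMetric_mlieBracket (hA : IsLift cov A X₁ Y₁) (hB : IsLift cov B X₂ Y₂)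
    (hC : IsLift cov C X₃ Y₃)
    (hcov : IsLeviCivita cov (fun x v w => g.inner x v w))
    (hX₁ : CMDiff ∞ (T% X₁)) (hY₁ : CMDiff ∞ (T% Y₁))
    (hX₂ : CMDiff ∞ (T% X₂)) (hY₂ : CMDiff ∞ (T% Y₂)) (P : TangentBundle I M) :
    liftMetric g cov m₁ m₂ m₃ P (mlieBracket I.tangent A B P) (C P) =
      m₁ * (g.inner P.proj (cov X₂ P.proj (X₁ P.proj)) (X₃ P.proj) -
        g.inner P.proj (cov X₁ P.proj (X₂ P.proj)) (X₃ P.proj)) +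
      m₂ * (g.inner P.proj (cov X₂ P.proj (X₁ P.proj)) (Y₃ P.proj) -
        g.inner P.proj (cov X₁ P.proj (X₂ P.proj)) (Y₃ P.proj) +
        (g.inner P.proj (cov Y₂ P.proj (X₁ P.proj)) (X₃ P.proj) -
        g.inner P.proj (cov Y₁ P.proj (X₂ P.proj)) (X₃ P.proj) -
        g.inner P.proj (curvature cov P.proj (X₁ P.proj) (X₂ P.proj) P.snd) (X₃ P.proj))) +
      m₃ * (g.inner P.proj (cov Y₂ P.proj (X₁ P.proj)) (Y₃ P.proj) -
        g.inner P.proj (cov Y₁ P.proj (X₂ P.proj)) (Y₃ P.proj) -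
        g.inner P.proj (curvature cov P.proj (X₁ P.proj) (X₂ P.proj) P.snd) (Y₃ P.proj)) := by
  simp only [liftMetric, hC.projMap, hC.connectionMap,
    hA.projMap_mlieBracket hB hcov hX₁ hY₁ hX₂ hY₂,
    hA.connectionMap_mlieBracket hB hcov hX₁ hY₁ hX₂ hY₂,
    hcov.mlieBracket_eq (mdiffAt_of_contMDiff hX₁ _) (mdiffAt_of_contMDiff hX₂ _), map_sub,
    _root_.sub_apply]

/-- The Koszul formula for lifts of vector fields. -/
theorem IsLift.koszul (hA : IsLift cov A X₁ Y₁) (hB : IsLift cov B X₂ Y₂) (hC : IsLift cov C X₃ Y₃)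
    (hcov : IsLeviCivita cov (fun x v w => g.inner x v w))
    (hbar : IsLeviCivita nablaBar (liftMetric g cov m₁ m₂ m₃))
    (hX₁ : CMDiff ∞ (T% X₁)) (hY₁ : CMDiff ∞ (T% Y₁))
    (hX₂ : CMDiff ∞ (T% X₂)) (hY₂ : CMDiff ∞ (T% Y₂))
    (hX₃ : CMDiff ∞ (T% X₃)) (hY₃ : CMDiff ∞ (T% Y₃)) (P : TangentBundle I M) :
    2 * liftMetric g cov m₁ m₂ m₃ P (nablaBar B P (A P)) (C P) =
      mvfderiv I.tangent (fun Q => liftMetric g cov m₁ m₂ m₃ Q (B Q) (C Q)) P (A P) +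
      mvfderiv I.tangent (fun Q => liftMetric g cov m₁ m₂ m₃ Q (C Q) (A Q)) P (B P) -
      mvfderiv I.tangent (fun Q => liftMetric g cov m₁ m₂ m₃ Q (A Q) (B Q)) P (C P) +
      liftMetric g cov m₁ m₂ m₃ P (mlieBracket I.tangent A B P) (C P) -
      liftMetric g cov m₁ m₂ m₃ P (mlieBracket I.tangent B C P) (A P) +
      liftMetric g cov m₁ m₂ m₃ P (mlieBracket I.tangent C A P) (B P) := by
  refine hbar.koszul (fun x v w => ?_) (fun x v v' w => ?_)
    (mdiffAt_of_contMDiff (hA.contMDiff hcov hX₁ hY₁) P)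
    (mdiffAt_of_contMDiff (hB.contMDiff hcov hX₂ hY₂) P)
    (mdiffAt_of_contMDiff (hC.contMDiff hcov hX₃ hY₃) P)
  · simp only [liftMetric, g.symm x.proj (TangentLift.projMap x v),
      g.symm x.proj (TangentLift.connectionMap cov x v)]
    ring
  · simp only [liftMetric, map_sub, _root_.sub_apply]
    ring

end Lift

/-! ### The Levi-Civita connection on sums of lifts -/

section Lift

variable {E : Type*} [NormedAddCommGroup E] [NormedSpace ℝ E] [FiniteDimensional ℝ E]
  {H : Type*} [TopologicalSpace H] {I : ModelWithCorners ℝ E H}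
  {M : Type*} [TopologicalSpace M] [ChartedSpace H M] [T2Space M] [IsManifold I ∞ M]
  {g : ContMDiffRiemannianMetric I ∞ E (TangentSpace I : M → Type _)}
  {cov : CovariantDerivative I E (TangentSpace I : M → Type _)}
  {A B C : ∀ Q : TangentBundle I M, TangentSpace I.tangent Q}
  {X₁ Y₁ X₂ Y₂ X₃ Y₃ : ∀ x : M, TangentSpace I x}
  {nablaBar : CovariantDerivative I.tangent (E × E)
    (TangentSpace I.tangent : TangentBundle I M → Type _)} {m₁ m₂ m₃ : ℝ}

/-- The Levi-Civita connection of the metric on the tangent bundle, on sums of horizontal and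
vertical lifts. -/
theorem IsLift.liftMetric_cov (hA : IsLift cov A X₁ Y₁) (hB : IsLift cov B X₂ Y₂)
    (hC : IsLift cov C X₃ Y₃)
    (hcov : IsLeviCivita cov (fun x v w => g.inner x v w))
    (hbar : IsLeviCivita nablaBar (liftMetric g cov m₁ m₂ m₃))
    (hX₁ : CMDiff ∞ (T% X₁)) (hY₁ : CMDiff ∞ (T% Y₁))
    (hX₂ : CMDiff ∞ (T% X₂)) (hY₂ : CMDiff ∞ (T% Y₂))
    (hX₃ : CMDiff ∞ (T% X₃)) (hY₃ : CMDiff ∞ (T% Y₃)) (p : M) (u : TangentSpace I p) :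
    2 * liftMetric g cov m₁ m₂ m₃ ⟨p, u⟩ (nablaBar B ⟨p, u⟩ (A ⟨p, u⟩)) (C ⟨p, u⟩) =
      2 * m₁ * g.inner p (cov X₂ p (X₁ p)) (X₃ p) +
      m₂ * (2 * g.inner p (cov X₂ p (X₁ p)) (Y₃ p) + 2 * g.inner p (cov Y₂ p (X₁ p)) (X₃ p) +
        2 * g.inner p (curvature cov p u (X₁ p) (X₂ p)) (X₃ p)) +
      m₃ * (2 * g.inner p (cov Y₂ p (X₁ p)) (Y₃ p) +
        g.inner p (curvature cov p u (Y₁ p) (X₂ p)) (X₃ p) +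
        g.inner p (curvature cov p u (Y₂ p) (X₁ p)) (X₃ p) -
        g.inner p (curvature cov p (X₁ p) (X₂ p) u) (Y₃ p)) := by
  rw [hA.koszul hB hC hcov hbar hX₁ hY₁ hX₂ hY₂ hX₃ hY₃,
    hA.mvfderiv_liftMetric hB hC hcov hX₂ hY₂ hX₃ hY₃,
    hB.mvfderiv_liftMetric hC hA hcov hX₃ hY₃ hX₁ hY₁,
    hC.mvfderiv_liftMetric hA hB hcov hX₁ hY₁ hX₂ hY₂,
    hA.liftMetric_mlieBracket hB hC hcov hX₁ hY₁ hX₂ hY₂,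
    hB.liftMetric_mlieBracket hC hA hcov hX₂ hY₂ hX₃ hY₃,
    hC.liftMetric_mlieBracket hA hB hcov hX₃ hY₃ hX₁ hY₁]
  -- What remains after the covariant derivatives cancel is curvature. Pair and skew symmetry bring
  -- the terms from `[B, C]` and `[C, A]` to the form `g(R(u, ·)·, X₃)`. This finishes the `m₃`
  -- terms; the three `m₂` terms collapse by Bianchi to `2 g(R(u, X₁)X₂, X₃)`.
  have e1 := inner_curvature_pair_symm hcov (X₂ p) (X₃ p) u (X₁ p)
  have e2 := inner_curvature_pair_symm hcov (X₃ p) (X₁ p) u (X₂ p)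
  have e3 := inner_curvature_pair_symm hcov (X₂ p) (X₃ p) u (Y₁ p)
  have e4 := inner_curvature_pair_symm hcov (X₃ p) (X₁ p) u (Y₂ p)
  have e5 := inner_curvature_skew hcov u (X₂ p) (X₃ p) (X₁ p)
  have e6 := inner_curvature_skew hcov u (Y₂ p) (X₃ p) (X₁ p)
  have e7 := congrArg (fun v => g.inner p v (X₃ p)) (curvature_bianchi hcov u (X₁ p) (X₂ p))
  have e8 := congrArg (fun v => g.inner p v (X₃ p)) (curvature_swap hcov (X₂ p) u (X₁ p))
  simp only [map_add, map_neg, map_zero, _root_.add_apply, _root_.neg_apply,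
    _root_.zero_apply] at e7 e8
  linear_combination m₂ * e1 - m₂ * e2 + m₃ * e3 - m₃ * e4 - m₂ * e5 - m₃ * e6 - m₂ * e7 + m₂ * e8

end Lift

end TangentLift

theorem mainTheorem2
    {E : Type*} [NormedAddCommGroup E] [NormedSpace ℝ E] [FiniteDimensional ℝ E]
    {M : Type*} [TopologicalSpace M] [T2Space M] [ChartedSpace E M] [IsManifold 𝓘(ℝ, E) ∞ M]
    (g : ContMDiffRiemannianMetric 𝓘(ℝ, E) ∞ E (TangentSpace 𝓘(ℝ, E) : M → Type _))
    (nabla : CovariantDerivative 𝓘(ℝ, E) E (TangentSpace 𝓘(ℝ, E) : M → Type _))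
    (hnabla : TangentLift.IsLeviCivita nabla (fun x v w => g.inner x v w))
    (m₁ m₂ m₃ : ℝ) (hm₁ : 0 < m₁) (hm₃ : 0 < m₃) (hm : 0 < m₁ * m₃ - m₂ ^ 2)
    (nablaBar : CovariantDerivative 𝓘(ℝ, E).tangent (E × E)
      (TangentSpace 𝓘(ℝ, E).tangent : TangentBundle 𝓘(ℝ, E) M → Type _))
    (hnablaBar : TangentLift.IsLeviCivita nablaBar (TangentLift.liftMetric g nabla m₁ m₂ m₃))
    (X Y Z : ∀ x : M, TangentSpace 𝓘(ℝ, E) x)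
    (hX : ContMDiff 𝓘(ℝ, E) 𝓘(ℝ, E).tangent ∞ (fun x => (⟨x, X x⟩ : TangentBundle 𝓘(ℝ, E) M)))
    (hY : ContMDiff 𝓘(ℝ, E) 𝓘(ℝ, E).tangent ∞ (fun x => (⟨x, Y x⟩ : TangentBundle 𝓘(ℝ, E) M)))
    (hZ : ContMDiff 𝓘(ℝ, E) 𝓘(ℝ, E).tangent ∞ (fun x => (⟨x, Z x⟩ : TangentBundle 𝓘(ℝ, E) M)))
    (p : M) (u : TangentSpace 𝓘(ℝ, E) p) :
    let P : TangentBundle 𝓘(ℝ, E) M := ⟨p, u⟩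
    let gBar := TangentLift.liftMetric g nabla m₁ m₂ m₃ P
    let R := TangentLift.curvature nabla p
    let Xh := TangentLift.hLift nabla X
    let Yh := TangentLift.hLift nabla Y
    let Zh := TangentLift.hLift nabla Z
    let Xv := TangentLift.vLift nabla X
    let Yv := TangentLift.vLift nabla Y
    let Zv := TangentLift.vLift nabla Z
    (2 * gBar (nablaBar Yh P (Xh P)) (Zh P) =
      2 * m₁ * g.inner p (nabla Y p (X p)) (Z p) + 2 * m₂ * g.inner p (R u (X p) (Y p)) (Z p)) ∧
    (2 * gBar (nablaBar Yh P (Xh P)) (Zv P) =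
      2 * m₂ * g.inner p (nabla Y p (X p)) (Z p) - m₃ * g.inner p (R (X p) (Y p) u) (Z p)) ∧
    (2 * gBar (nablaBar Yv P (Xh P)) (Zh P) =
      2 * m₂ * g.inner p (nabla Y p (X p)) (Z p) + m₃ * g.inner p (R u (Y p) (X p)) (Z p)) ∧
    (2 * gBar (nablaBar Yv P (Xh P)) (Zv P) =
      2 * m₃ * g.inner p (nabla Y p (X p)) (Z p)) ∧
    (2 * gBar (nablaBar Yh P (Xv P)) (Zh P) =
      m₃ * g.inner p (R u (X p) (Y p)) (Z p)) ∧
    (2 * gBar (nablaBar Yh P (Xv P)) (Zv P) = 0) ∧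
    (2 * gBar (nablaBar Yv P (Xv P)) (Zh P) = 0) ∧
    (2 * gBar (nablaBar Yv P (Xv P)) (Zv P) = 0) := by
  intro P gBar R Xh Yh Zh Xv Yv Zv
  have h0 : ContMDiff 𝓘(ℝ, E) 𝓘(ℝ, E).tangent ∞
      (fun x => (⟨x, (0 : ∀ x : M, TangentSpace 𝓘(ℝ, E) x) x⟩ : TangentBundle 𝓘(ℝ, E) M)) :=
    TangentLift.contMDiff_zero
  have lX := TangentLift.isLift_hLift (cov := nabla) X
  have lY := TangentLift.isLift_hLift (cov := nabla) Y
  have lZ := TangentLift.isLift_hLift (cov := nabla) Z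
  have vX := TangentLift.isLift_vLift (cov := nabla) X
  have vY := TangentLift.isLift_vLift (cov := nabla) Y
  have vZ := TangentLift.isLift_vLift (cov := nabla) Z
  -- A horizontal lift has the zero field as its `K` part, a vertical lift as its `dπ` part; each
  -- identity is the general formula with three of the six fields zero.
  refine ⟨(lX.liftMetric_cov lY lZ hnabla hnablaBar hX h0 hY h0 hZ h0 p u).trans ?_,
    (lX.liftMetric_cov lY vZ hnabla hnablaBar hX h0 hY h0 h0 hZ p u).trans ?_,
    (lX.liftMetric_cov vY lZ hnabla hnablaBar hX h0 h0 hY hZ h0 p u).trans ?_,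
    (lX.liftMetric_cov vY vZ hnabla hnablaBar hX h0 h0 hY h0 hZ p u).trans ?_,
    (vX.liftMetric_cov lY lZ hnabla hnablaBar h0 hX hY h0 hZ h0 p u).trans ?_,
    (vX.liftMetric_cov lY vZ hnabla hnablaBar h0 hX hY h0 h0 hZ p u).trans ?_,
    (vX.liftMetric_cov vY lZ hnabla hnablaBar h0 hX h0 hY hZ h0 p u).trans ?_,
    (vX.liftMetric_cov vY vZ hnabla hnablaBar h0 hX h0 hY h0 hZ p u).trans ?_⟩
  all_goals
    simp [R, TangentLift.curvature_zero_left hnabla, TangentLift.curvature_zero_right hnabla,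
      TangentLift.curvature_apply_zero hnabla]
  all_goals ring
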